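/- Let $(f_t)_{t\ge 0}$ be a real-valued additive process (independent increments, $f_0=0$ a.s.). For complex $u$ write $\phi_t(u)=\mathbb E\,e^{iuf_t}$, and for $0\le s<t$ write $\phi_{s,t}(u)=\mathbb E\,e^{iu(f_t-f_s)}$ and $P(x)=\mathbb P(f_t-f_s\le x)$. For $t>0$ let $p^-_t>0$ and $-(p_t^++1)<-1$ be such that $\phi_t$ is well defined and analytic in the strip $-(p^+_t+1)<\Im u<p^-_t$. Assume: (Assumption 1) $p^+_t$ and $p^-_t$ are non-increasing in $t>0$. (Assumption 2) For all $t>s\ge 0$ there are $B,b,\omega>0$ (depending on $s,t$) such that, for all sufficiently large real $u$, $|\phi_{s,t}(u-ia)|<B e^{-bu^\omega}$ for all $a\in(0,p_t^++1)$. Fix $0\le s<t$, constants $B,b,\omega$ as in Assumption 2, and put $q=p_t^++1$. For a shift $a\in(0,q)$, a step $h>0$ and $N\in\mathbb N$ let $$\hat P_a(x)=1-\frac{e^{-ax}}{\pi}\sum_{l=0}^{N-1}\mathrm{Re}\left[\frac{e^{-i(l+1/2)hx}\,\phi_{s,t}((l+1/2)h-ia)}{i(l+1/2)h+a}\right]h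 .$$ This is the $N$-point midpoint discretization of the Lewis formula: $\phi_{s,t}$ is well defined and analytic for $-(p_t^++1)<\Im u<p_t^-$ and, for every $a\in(0,q)$ and $x\in\mathbb R$, with an integrable integrand, $$P(x)=1-\frac{e^{-ax}}{\pi}\int_0^\infty \mathrm{Re}\left[\frac{e^{-iux}\phi_{s,t}(u-ia)}{iu+a}\right]du .$$ Then, with $\Gamma(z,v)=\int_v^\infty r^{z-1}e^{-r}\,dr$ the upper incomplete gamma function: 1. There is $U>0$ such that, for all $h>0$ and $N$ with $Nh\ge U$ and all $x\in\mathbb R$, the shift $a=q/2$ gives, provided that $\phi_{s,t}(-iq)=\mathbb E\,e^{q(f_t-f_s)}$ is finite, $$|P(x)-\hat P_{q/2}(x)|\le \mathcal E(x):=\frac{B}{\pi}\,\frac{e^{-xq/2}}{\omega\, b^{1/\omega}}\,\frac1{Nh}\,\Gamma\!\left[\tfrac1\omega,b(Nh)^\omega\right]+\frac{e^{-\pi q/h}+e^{-\pi q/h-qx}\,\phi_{s,t}(-iq)}{1-e^{-2\pi q/h}} .$$ More generally, for every shift $a\in(0,q)$ and every $p\in(a,q]$ with $\phi_{s,t}(-ip)$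 finite, $$|P(x)-\hat P_a(x)|\le\frac{B}{\pi}\frac{e^{-ax}}{\omega b^{1/\omega}}\frac1{Nh}\Gamma\!\left[\tfrac1\omega,b(Nh)^\omega\right]+D_{a,p}(h),\qquad D_{a,p}(h)=\frac{e^{-2\pi a/h}}{1-e^{-4\pi a/h}}+\frac{e^{-2\pi(p-a)/h-px}}{1-e^{-4\pi(p-a)/h}}\,\phi_{s,t}(-ip) .$$ As $y\to\infty$, $\frac1y\Gamma[\frac1\omega,by^\omega]=O(y^{-\omega}e^{-by^\omega})$; thus the range term is of order $(Nh)^{-\omega}e^{-b(Nh)^\omega}$. If $\phi_{s,t}(-iq)$ is finite, the second term of $\mathcal E(x)$ equals $D_{q/2,q}(h)$ and is $O(e^{-\pi q/h})$ as $h\to0^+$, for each fixed $x$. 2. The shift $a=q/2$ is the one that makes the exponential decay in $1/h$ of the discretization bound fastest: for every shift $a\in(0,q)$ with $a\ne q/2$ there is $p\in(q/2,q)$ such that, for every $p'\in(a,q]$ with $\phi_{s,t}(-ip')$ finite and every $x$, $D_{q/2,p}(h)=o(D_{a,p'}(h))$ as $h\to0^+$. If $\phi_{s,t}(-iq)$ is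 finite, then for every $x$, $D_{q/2,q}(h)=o(D_{a,p}(h))$ as $h\to0^+$ for all $a\in(0,q)$ and $p\in(a,q]$ with $(a,p)\ne(q/2,q)$. -/

import Mathlib

open MeasureTheory ProbabilityTheory Filter Set Topology Asymptotics
open scoped NNReal

namespace LewisCDF

noncomputable section

/-- Additive process: a real-valued process, null at time `0` almost surely, with independent
(not necessarily stationary) increments. -/
structure IsAdditiveProcess {Ω : Type*} [MeasurableSpace Ω] (μ : Measure Ω)
    (f : ℝ≥0 → Ω → ℝ) : Prop where
  measurable : ∀ t, Measurable (f t)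
  zero : ∀ᵐ ω ∂μ, f 0 ω = 0
  indep : HasIndepIncrements f μ

/-- The increment `f_t - f_s`. -/
def incr {Ω : Type*} (f : ℝ≥0 → Ω → ℝ) (s t : ℝ≥0) : Ω → ℝ := fun ω => f t ω - f s ω

/-- The characteristic function `u ↦ E exp (i u X)` at a complex argument `u`. -/
def charFn {Ω : Type*} [MeasurableSpace Ω] (μ : Measure Ω) (X : Ω → ℝ) (u : ℂ) : ℂ :=
  ∫ ω, Complex.exp (Complex.I * u * (X ω : ℂ)) ∂μ

/-- The characteristic function `φ_{s,t}` of the increment `f_t - f_s`. -/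
def incrCharFn {Ω : Type*} [MeasurableSpace Ω] (μ : Measure Ω) (f : ℝ≥0 → Ω → ℝ)
    (s t : ℝ≥0) : ℂ → ℂ :=
  charFn μ (incr f s t)

/-- The cumulative distribution function `P` of the increment `f_t - f_s`. -/
def incrCDF {Ω : Type*} [MeasurableSpace Ω] (μ : Measure Ω) (f : ℝ≥0 → Ω → ℝ)
    (s t : ℝ≥0) (x : ℝ) : ℝ :=
  μ.real {ω | incr f s t ω ≤ x}

/-- The horizontal strip `-(p⁺ + 1) < Im u < p⁻`. -/
def strip (pm pp : ℝ) : Set ℂ := {u | -(pp + 1) < u.im ∧ u.im < pm}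

/-- `p⁻ > 0` and `-(p⁺ + 1) < -1` bound a strip in which the characteristic function of `X` is
well defined (the expectation converges) and analytic. The strip need not be the largest one. -/
structure IsAnalyticityStrip {Ω : Type*} [MeasurableSpace Ω] (μ : Measure Ω) (X : Ω → ℝ)
    (pm pp : ℝ) : Prop where
  pm_pos : 0 < pm
  pp_bound : -(pp + 1) < -1
  integrable : ∀ u ∈ strip pm pp,
    Integrable (fun ω => Complex.exp (Complex.I * u * (X ω : ℂ))) μ
  analytic : AnalyticOnNhd ℂ (charFn μ X) (strip pm pp)

/-- Exponential decay `|φ (u - i a)| < B exp (-b u ^ w)`, for `u` sufficiently large, for all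
shifts `a ∈ (0, p⁺ + 1)`. -/
def ExpDecay (φ : ℂ → ℂ) (pp B b w : ℝ) : Prop :=
  0 < B ∧ 0 < b ∧ 0 < w ∧
    ∀ᶠ u : ℝ in atTop, ∀ a ∈ Ioo 0 (pp + 1),
      ‖φ ((u : ℂ) - Complex.I * (a : ℂ))‖ < B * Real.exp (-b * u ^ w)

/-- The integrand `Re [exp (-i u x) φ (u - i a) / (i u + a)]` of the Lewis formula. -/
def lewisIntegrand (φ : ℂ → ℂ) (a x u : ℝ) : ℝ :=
  (Complex.exp (-(Complex.I * (u : ℂ) * (x : ℂ))) * φ ((u : ℂ) - Complex.I * (a : ℂ)) /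
    (Complex.I * (u : ℂ) + (a : ℂ))).re

/-- The Lewis formula with a shift `a > 0` (the residue constant is then `1`). -/
def lewisCDF (φ : ℂ → ℂ) (a x : ℝ) : ℝ :=
  1 - Real.exp (-a * x) / Real.pi * ∫ u in Ioi (0 : ℝ), lewisIntegrand φ a x u

/-- The discretized Lewis formula: `N` midpoints, step `h`. -/
def lewisSum (φ : ℂ → ℂ) (a h : ℝ) (N : ℕ) (x : ℝ) : ℝ :=
  1 - Real.exp (-a * x) / Real.pi *
    ∑ l ∈ Finset.range N, lewisIntegrand φ a x (((l : ℝ) + 1 / 2) * h) * h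

/-- The upper incomplete gamma function `Γ(z, v)`. -/
def upperGamma (z v : ℝ) : ℝ := ∫ r in Ioi v, r ^ (z - 1) * Real.exp (-r)

/-- Range error term for the shift `a` and the truncation point `y = N h`. -/
def rangeError (a B b w y x : ℝ) : ℝ :=
  B / Real.pi * (Real.exp (-a * x) / (w * b ^ (1 / w))) * (1 / y) *
    upperGamma (1 / w) (b * y ^ w)

/-- Discretization error term for the shift `a` and the moment of order `p`,
`φ (-i p) = E exp (p X)`. -/
def discError (φ : ℂ → ℂ) (a p h x : ℝ) : ℝ :=
  Real.exp (-2 * Real.pi * a / h) / (1 - Real.exp (-4 * Real.pi * a / h)) +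
    Real.exp (-2 * Real.pi * (p - a) / h - p * x) /
      (1 - Real.exp (-4 * Real.pi * (p - a) / h)) * (φ (-Complex.I * (p : ℂ))).re

/-- The discretization term of the error bound `E^{CDF}_{h,M}`, with `q = p⁺ + 1`. -/
def discTerm (φ : ℂ → ℂ) (q h x : ℝ) : ℝ :=
  (Real.exp (-Real.pi * q / h) +
      Real.exp (-Real.pi * q / h - q * x) * (φ (-Complex.I * (q : ℂ))).re) /
    (1 - Real.exp (-2 * Real.pi * q / h))

/-- The error bound `E^{CDF}_{h,M}(x)`, with `q = p⁺ + 1`. -/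
def errorCDF (φ : ℂ → ℂ) (q B b w h : ℝ) (N : ℕ) (x : ℝ) : ℝ :=
  B / Real.pi * (Real.exp (-x * q / 2) / (w * b ^ (1 / w))) * (1 / ((N : ℝ) * h)) *
      upperGamma (1 / w) (b * ((N : ℝ) * h) ^ w) +
    discTerm φ q h x

end

end LewisCDF

open LewisCDF

namespace LewisCDF

/-! ### Exponential moments and the strip of analyticity. -/

section CharacteristicFunction

variable {Ω : Type*} [MeasurableSpace Ω] {μ : Measure Ω} {X : Ω → ℝ}

/-! Everything rests on the weighted tail `G(y) = exp (a y) P(X > y)` of the increment `X`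
(`expTail`). By Fubini its two-sided transform is `E exp (s X) / s`, so the Lewis kernel is exactly
the Fourier transform of `G` (`lewisKernel_eq_integral`). The decay assumption makes the kernel
integrable. Fourier inversion then recovers `G`, first at its continuity points and then everywhere
by right-continuity. This is the Lewis formula, and it also shows that `G` is continuous.

The midpoint sum samples that transform at `(n + 1/2) h`. Poisson summation (`tsum_modulatedTail`)
turns the untruncated sum into `∑ (-1)^n G(x - 2πn/h)`, where the half-integer offset produces the
signs. The term `n = 0` is the exact tail; the others are the discretization error. On one side they
are bounded by `P ≤ 1`, on the other by Chernoff's inequality with the moment of order `p`, giving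
geometric ratios `exp (-2πa/h)` and `exp (-2π(p-a)/h)`. Because the signs alternate, each side costs
only the odd part of its geometric series, hence the denominators `1 - r ^ 2` in `discError`.

Truncation drops the midpoints beyond `N h`. There `1/u ≤ 1/(N h)`, and `exp (-b u^w)` is convex
once `N h` is large, so its midpoint sum is below its integral, an incomplete gamma function.

For optimality, `discError` has exact order `exp (-2π m/h)` with `m = min a (p - a)`. Under `p ≤ q`
this rate is at most `q/2`, with equality only at `a = q/2`, `p = q`. -/

lemma charFn_eq_complexMGF (u : ℂ) : charFn μ X u = complexMGF X μ (Complex.I * u) := rfl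

lemma norm_exp_I_mul (u : ℂ) (r : ℝ) :
    ‖Complex.exp (Complex.I * u * (r : ℂ))‖ = Real.exp (-u.im * r) := by
  rw [Complex.norm_exp]
  simp

lemma norm_exp_mul_ofReal (s : ℂ) (r : ℝ) :
    ‖Complex.exp (s * (r : ℂ))‖ = Real.exp (s.re * r) := by
  rw [Complex.norm_exp]
  simp

lemma charFn_sub_I_mul (a u : ℝ) :
    charFn μ X ((u : ℂ) - Complex.I * (a : ℂ)) =
      ∫ ω, Complex.exp ((Complex.I * (u : ℂ) + (a : ℂ)) * (X ω : ℂ)) ∂μ := by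
  have h : Complex.I * ((u : ℂ) - Complex.I * (a : ℂ)) = Complex.I * (u : ℂ) + (a : ℂ) := by
    linear_combination (-(a : ℂ)) * Complex.I_mul_I
  simp only [charFn, h]

lemma charFn_neg_sub_I_mul (a u : ℝ) :
    charFn μ X (((-u : ℝ) : ℂ) - Complex.I * (a : ℂ)) =
      (starRingEnd ℂ) (charFn μ X ((u : ℂ) - Complex.I * (a : ℂ))) := by
  rw [charFn_sub_I_mul, charFn_sub_I_mul, ← integral_conj]
  congr with ω
  rw [← Complex.exp_conj]
  simp

lemma charFn_neg_I_mul_re (p : ℝ) :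
    (charFn μ X (-Complex.I * (p : ℂ))).re = mgf X μ p := by
  rw [charFn_eq_complexMGF, ← re_complexMGF_ofReal]
  congr 2
  linear_combination (-(p : ℂ)) * Complex.I_mul_I

/-- A random variable with exponential moments of all orders in `(-pm, pp + 1)` has a
characteristic function that is analytic in the corresponding strip. -/
lemma isAnalyticityStrip_of_integrable {pm pp : ℝ} (hX : AEMeasurable X μ) (hpm : 0 < pm)
    (hpp : -(pp + 1) < -1)
    (h : ∀ c ∈ Ioo (-pm) (pp + 1), Integrable (fun ω => Real.exp (c * X ω)) μ) :
    IsAnalyticityStrip μ X pm pp where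
  pm_pos := hpm
  pp_bound := hpp
  integrable u hu := by
    have hu' : -u.im ∈ Ioo (-pm) (pp + 1) := ⟨by linarith [hu.2], by linarith [hu.1]⟩
    refine (h _ hu').mono' ?_ (.of_forall fun ω => (norm_exp_I_mul u (X ω)).le)
    have : Measurable fun r : ℝ => Complex.exp (Complex.I * u * (r : ℂ)) := by fun_prop
    exact (this.comp_aemeasurable hX).aestronglyMeasurable
  analytic u hu := by
    have hu' : -u.im ∈ Ioo (-pm) (pp + 1) := ⟨by linarith [hu.2], by linarith [hu.1]⟩
    have hmem : (Complex.I * u).re ∈ interior (integrableExpSet X μ) := by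
      have : Ioo (-pm) (pp + 1) ⊆ interior (integrableExpSet X μ) :=
        isOpen_Ioo.subset_interior_iff.2 h
      exact this (by simpa using hu')
    exact (analyticAt_complexMGF hmem).fun_comp (analyticAt_const.mul analyticAt_id)

lemma IsAnalyticityStrip.integrable_exp {pm pp : ℝ} (h : IsAnalyticityStrip μ X pm pp) {c : ℝ}
    (hc : c ∈ Ioo (-pm) (pp + 1)) : Integrable (fun ω => Real.exp (c * X ω)) μ := by
  have hmem : -(Complex.I * (c : ℂ)) ∈ strip pm pp := by
    constructor <;> simp <;> linarith [hc.1, hc.2]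
  refine (h.integrable _ hmem).norm.congr (.of_forall fun ω => ?_)
  simp only [norm_exp_I_mul]
  simp

end CharacteristicFunction

/-! ### Increments inherit the moments of the process. -/

section Increments

variable {Ω : Type*} [MeasurableSpace Ω] {μ : Measure Ω} {f : ℝ≥0 → Ω → ℝ}

lemma IsAdditiveProcess.measurable_incr (hf : IsAdditiveProcess μ f) (s t : ℝ≥0) :
    Measurable (incr f s t) :=
  (hf.measurable t).sub (hf.measurable s)

variable [IsProbabilityMeasure μ]

/-- An exponential moment of `f_t` is inherited by the increments `f_t - f_s`. -/
lemma IsAdditiveProcess.integrable_exp_incr (hf : IsAdditiveProcess μ f) {s t : ℝ≥0}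
    (hst : s ≤ t) {c : ℝ} (h : Integrable (fun ω => Real.exp (c * f t ω)) μ) :
    Integrable (fun ω => Real.exp (c * incr f s t ω)) μ := by
  have hm : Measurable fun r : ℝ => Real.exp (c * r) := by fun_prop
  have hind : (fun ω => Real.exp (c * f s ω)) ⟂ᵢ[μ] fun ω => Real.exp (c * incr f s t ω) :=
    (hf.indep.indepFun_eval_sub (zero_le (a := s)) hst hf.zero).comp hm hm
  -- `exp (c f_t)` is the product of two independent factors. Since the factor `exp (c f_s)` is not
  -- almost surely zero, integrability of the product forces that of the other factor.
  refine hind.integrable_right_of_integrable_op (fun x y => x * y) 1 one_ne_zero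
    (fun x y => by simp [enorm_mul]) ?_
    (hm.comp (hf.measurable s)).aestronglyMeasurable
    (hm.comp (hf.measurable_incr s t)).aestronglyMeasurable ?_
  · refine h.congr (.of_forall fun ω => ?_)
    simp only [incr, ← Real.exp_add]
    ring_nf
  · intro h0
    have : ∀ᵐ _ : Ω ∂μ, False := by
      filter_upwards [h0] with ω hω
      exact (Real.exp_pos _).ne' hω
    simp [IsProbabilityMeasure.ne_zero] at this

lemma IsAdditiveProcess.isAnalyticityStrip_incr (hf : IsAdditiveProcess μ f) {s t : ℝ≥0}
    (hst : s ≤ t) {pm pp : ℝ} (h : IsAnalyticityStrip μ (f t) pm pp) :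
    IsAnalyticityStrip μ (incr f s t) pm pp :=
  isAnalyticityStrip_of_integrable (hf.measurable_incr s t).aemeasurable h.pm_pos h.pp_bound
    fun _ hc => hf.integrable_exp_incr hst (h.integrable_exp hc)

end Increments

/-! ### The weighted tail and its Laplace transform. -/

section Tail

variable {Ω : Type*} [MeasurableSpace Ω] {μ : Measure Ω} {X : Ω → ℝ}

/-- The exponentially weighted tail `y ↦ exp (a y) P(y < X)`. -/
noncomputable def expTail (μ : Measure Ω) (X : Ω → ℝ) (a y : ℝ) : ℝ :=
  Real.exp (a * y) * μ.real {ω | y < X ω}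

lemma expTail_nonneg (a y : ℝ) : 0 ≤ expTail μ X a y := by
  unfold expTail; positivity

/-- This justifies the Fubini exchange: for `Re s > 0`, integrating the norm over `y < X` gives `exp
(Re s * X) / Re s`, which is integrable by hypothesis. -/
lemma integrable_indicator_exp_prod (hX : Measurable X) {s : ℂ} (hs : 0 < s.re)
    (h : Integrable (fun ω => Real.exp (s.re * X ω)) μ) :
    Integrable (Function.uncurry fun (ω : Ω) (y : ℝ) =>
      (Iio (X ω)).indicator (fun y : ℝ => Complex.exp (s * (y : ℂ))) y) (μ.prod volume) := by
  have hm : Measurable (Function.uncurry fun (ω : Ω) (y : ℝ) =>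
      (Iio (X ω)).indicator (fun y : ℝ => Complex.exp (s * (y : ℂ))) y) := by
    have hset : MeasurableSet {p : Ω × ℝ | p.2 < X p.1} :=
      measurableSet_lt measurable_snd (hX.comp measurable_fst)
    have hfun : Measurable fun p : Ω × ℝ => Complex.exp (s * (p.2 : ℂ)) := by fun_prop
    exact hfun.indicator hset
  rw [integrable_prod_iff hm.aestronglyMeasurable]
  constructor
  · refine .of_forall fun ω => ?_
    exact ((integrableOn_exp_mul_complex_Iic hs (X ω)).mono_set
      Iio_subset_Iic_self).integrable_indicator measurableSet_Iio
  · refine (h.div_const s.re).congr (.of_forall fun ω => ?_)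
    simp only [Function.uncurry_apply_pair, norm_indicator_eq_indicator_norm, norm_exp_mul_ofReal]
    rw [integral_indicator measurableSet_Iio, ← integral_Iic_eq_integral_Iio,
      integral_exp_mul_Iic hs]

lemma integral_indicator_exp (hX : Measurable X) (s : ℂ) (y : ℝ) :
    ∫ ω, (Iio (X ω)).indicator (fun y : ℝ => Complex.exp (s * (y : ℂ))) y ∂μ =
      Complex.exp (s * (y : ℂ)) * (μ.real {ω | y < X ω} : ℂ) := by
  have hset : MeasurableSet {ω | y < X ω} := measurableSet_lt measurable_const hX
  have : (fun ω => (Iio (X ω)).indicator (fun y : ℝ => Complex.exp (s * (y : ℂ))) y) =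
      {ω | y < X ω}.indicator fun _ => Complex.exp (s * (y : ℂ)) := by
    ext ω
    simp [indicator]
  rw [this, integral_indicator hset, setIntegral_const]
  simp [mul_comm]

variable [IsProbabilityMeasure μ]

lemma expTail_le_exp (a y : ℝ) : expTail μ X a y ≤ Real.exp (a * y) :=
  mul_le_of_le_one_right (Real.exp_pos _).le measureReal_le_one

/-- Chernoff's inequality. With `p > a` it gives decay at `+∞`, complementing `expTail_le_exp`,
which gives decay at `-∞` when `a > 0`. -/
lemma expTail_le_exp_mul_mgf {p : ℝ} (hp : 0 ≤ p)
    (h : Integrable (fun ω => Real.exp (p * X ω)) μ) (a y : ℝ) :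
    expTail μ X a y ≤ Real.exp ((a - p) * y) * mgf X μ p := by
  have h1 : μ.real {ω | y < X ω} ≤ Real.exp (-p * y) * mgf X μ p :=
    (measureReal_mono (fun ω (hω : y < X ω) => le_of_lt hω) (measure_ne_top _ _)).trans (measure_ge_le_exp_mul_mgf y hp h)
  calc expTail μ X a y ≤ Real.exp (a * y) * (Real.exp (-p * y) * mgf X μ p) :=
        mul_le_mul_of_nonneg_left h1 (Real.exp_pos _).le
    _ = Real.exp ((a - p) * y) * mgf X μ p := by
        rw [← mul_assoc, ← Real.exp_add]; ring_nf

lemma measureReal_gt_eq_one_sub_cdf (hX : Measurable X) (y : ℝ) :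
    μ.real {ω | y < X ω} = 1 - cdf (μ.map X) y := by
  have := Measure.isProbabilityMeasure_map (μ := μ) hX.aemeasurable
  rw [cdf_eq_real, map_measureReal_apply hX measurableSet_Iic,
    ← probReal_compl_eq_one_sub (hX measurableSet_Iic)]
  congr 1
  ext ω
  simp

lemma expTail_eq (hX : Measurable X) (a : ℝ) :
    expTail μ X a = fun y => Real.exp (a * y) * (1 - cdf (μ.map X) y) := by
  ext y
  rw [expTail, measureReal_gt_eq_one_sub_cdf hX]

lemma continuousWithinAt_expTail (hX : Measurable X) (a y : ℝ) :
    ContinuousWithinAt (expTail μ X a) (Ici y) y := by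
  rw [expTail_eq hX]
  exact (Continuous.continuousWithinAt (by fun_prop)).mul
    (continuousWithinAt_const.sub ((cdf (μ.map X)).right_continuous y))

lemma countable_not_continuousAt_expTail (hX : Measurable X) (a : ℝ) :
    {y | ¬ContinuousAt (expTail μ X a) y}.Countable := by
  refine (cdf (μ.map X)).mono.countable_not_continuousAt.mono ?_
  refine fun y hy hc => hy ?_
  rw [expTail_eq hX]
  exact (Continuous.continuousAt (by fun_prop)).mul (continuousAt_const.sub hc)

/-- A function that agrees with the weighted tail at all its continuity points and is continuous
is the weighted tail. -/
lemma expTail_eq_of_continuous (hX : Measurable X) (a : ℝ) {g : ℝ → ℝ} (hg : Continuous g)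
    (h : ∀ y, ContinuousAt (expTail μ X a) y → g y = expTail μ X a y) :
    g = expTail μ X a := by
  ext y
  set D := {y | ¬ContinuousAt (expTail μ X a) y}ᶜ
  have hD : Dense D := (countable_not_continuousAt_expTail hX a).dense_compl ℝ
  -- The continuity points are dense, so `y` is a limit of such points from the right, where
  -- right-continuity of the tail applies.
  have hy : y ∈ closure (Ioi y ∩ D) := by
    have h1 := closure_minimal (hD.open_subset_closure_inter (isOpen_Ioi (a := y)))
      isClosed_closure
    exact h1 (by simp [closure_Ioi])
  have := mem_closure_iff_nhdsWithin_neBot.1 hy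
  have h1 : Tendsto g (𝓝[Ioi y ∩ D] y) (𝓝 (g y)) := hg.continuousAt.mono_left inf_le_left
  have h2 : Tendsto (expTail μ X a) (𝓝[Ioi y ∩ D] y) (𝓝 (expTail μ X a y)) :=
    (continuousWithinAt_expTail hX a y).mono fun z hz => mem_Ici.2 (le_of_lt hz.1)
  refine tendsto_nhds_unique (h1.congr' ?_) h2
  filter_upwards [self_mem_nhdsWithin] with z hz
  exact h z (not_not.1 hz.2)

lemma integrable_exp_mul_tail (hX : Measurable X) {s : ℂ} (hs : 0 < s.re)
    (h : Integrable (fun ω => Real.exp (s.re * X ω)) μ) :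
    Integrable fun y : ℝ => Complex.exp (s * (y : ℂ)) * (μ.real {ω | y < X ω} : ℂ) := by
  simpa only [integral_indicator_exp hX, Function.uncurry_apply_pair] using
    (integrable_indicator_exp_prod hX hs h).integral_prod_right

/-- The two-sided Laplace transform of the tail of a distribution. -/
lemma integral_exp_mul_tail (hX : Measurable X) {s : ℂ} (hs : 0 < s.re)
    (h : Integrable (fun ω => Real.exp (s.re * X ω)) μ) :
    ∫ y : ℝ, Complex.exp (s * (y : ℂ)) * (μ.real {ω | y < X ω} : ℂ) =
      (∫ ω, Complex.exp (s * (X ω : ℂ)) ∂μ) / s := by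
  simp_rw [← integral_indicator_exp hX]
  rw [← integral_integral_swap (integrable_indicator_exp_prod hX hs h), ← integral_div]
  congr with ω
  rw [integral_indicator measurableSet_Iio, ← integral_Iic_eq_integral_Iio,
    integral_exp_mul_complex_Iic hs]

lemma integrable_expTail (hX : Measurable X) {a : ℝ} (ha : 0 < a)
    (h : Integrable (fun ω => Real.exp (a * X ω)) μ) : Integrable (expTail μ X a) := by
  have := (integrable_exp_mul_tail hX (s := (a : ℂ)) (by simpa) (by simpa)).re
  refine this.congr (.of_forall fun y => ?_)
  simp only [expTail, ← Complex.ofReal_mul, ← Complex.ofReal_exp]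
  rfl

end Tail

/-! ### The Lewis kernel and Fourier inversion. -/

/-- The complex kernel whose real part is the Lewis integrand. -/
noncomputable def lewisKernel (φ : ℂ → ℂ) (a x u : ℝ) : ℂ :=
  Complex.exp (-(Complex.I * (u : ℂ) * (x : ℂ))) * φ ((u : ℂ) - Complex.I * (a : ℂ)) /
    (Complex.I * (u : ℂ) + (a : ℂ))

lemma lewisKernel_re (φ : ℂ → ℂ) (a x u : ℝ) :
    (lewisKernel φ a x u).re = lewisIntegrand φ a x u := rfl

lemma norm_lewisKernel (φ : ℂ → ℂ) (a x u : ℝ) :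
    ‖lewisKernel φ a x u‖ =
      ‖φ ((u : ℂ) - Complex.I * (a : ℂ))‖ / ‖Complex.I * (u : ℂ) + (a : ℂ)‖ := by
  rw [lewisKernel, norm_div, norm_mul, Complex.norm_exp]
  simp

lemma abs_le_norm_I_mul_add (a u : ℝ) : |u| ≤ ‖Complex.I * (u : ℂ) + (a : ℂ)‖ := by
  simpa using Complex.abs_im_le_norm (Complex.I * (u : ℂ) + (a : ℂ))

/-- Pointwise bound for the kernel where the characteristic function is bounded. -/
lemma norm_lewisKernel_le {φ : ℂ → ℂ} {a u C : ℝ} (hu : 0 < u)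
    (h : ‖φ ((u : ℂ) - Complex.I * (a : ℂ))‖ ≤ C) (x : ℝ) : ‖lewisKernel φ a x u‖ ≤ C / u := by
  rw [norm_lewisKernel]
  have h1 := abs_le_norm_I_mul_add a u
  rw [abs_of_pos hu] at h1
  exact div_le_div₀ ((norm_nonneg _).trans h) h hu h1

lemma isBigO_exp_neg_mul_rpow {b w : ℝ} (hb : 0 < b) (hw : 0 < w) (r : ℝ) :
    (fun u : ℝ => Real.exp (-b * u ^ w)) =O[atTop] fun u : ℝ => u ^ r := by
  have h := (isLittleO_exp_neg_mul_rpow_atTop hb (r / w)).isBigO.comp_tendsto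
    (tendsto_rpow_atTop hw)
  refine h.congr' .rfl ?_
  filter_upwards [eventually_ge_atTop 0] with u hu
  simp only [Function.comp]
  rw [← Real.rpow_mul hu, mul_div_cancel₀ _ hw.ne']

lemma isBigO_lewisKernel {φ : ℂ → ℂ} {a B b w : ℝ} (hb : 0 < b) (hw : 0 < w)
    (hdec : ∀ᶠ u : ℝ in atTop,
      ‖φ ((u : ℂ) - Complex.I * (a : ℂ))‖ < B * Real.exp (-b * u ^ w)) (x r : ℝ) :
    lewisKernel φ a x =O[atTop] fun u : ℝ => u ^ r := by
  refine IsBigO.trans (.of_bound B ?_) (isBigO_exp_neg_mul_rpow hb hw r)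
  filter_upwards [hdec, eventually_ge_atTop 1] with u hu hu1
  refine (norm_lewisKernel_le (by linarith) hu.le x).trans ?_
  rw [Real.norm_of_nonneg (Real.exp_pos _).le]
  exact div_le_self ((norm_nonneg _).trans hu.le) hu1

/-- The variable `x` enters only through a phase, so the kernel at `x = 0` dominates all the others.
-/
lemma continuous_integral_lewisKernel {φ : ℂ → ℂ} {a : ℝ}
    (hL : ∀ x, Integrable (lewisKernel φ a x)) :
    Continuous fun x => ∫ u, lewisKernel φ a x u := by
  refine continuous_of_dominated (bound := fun u => ‖lewisKernel φ a 0 u‖)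
    (fun x => (hL x).aestronglyMeasurable) (fun x => .of_forall fun u => ?_) (hL 0).norm
    (.of_forall fun u => ?_)
  · rw [norm_lewisKernel, norm_lewisKernel]
  · unfold lewisKernel
    fun_prop

section Random

variable {Ω : Type*} [MeasurableSpace Ω] {μ : Measure Ω} {X : Ω → ℝ}

/-- Hermitian symmetry, valid because `X` is real. It folds integrals and sums over negative
frequencies into twice a real part over positive ones. -/
lemma lewisKernel_neg (a x u : ℝ) :
    lewisKernel (charFn μ X) a x (-u) = (starRingEnd ℂ) (lewisKernel (charFn μ X) a x u) := by
  rw [lewisKernel, lewisKernel, charFn_neg_sub_I_mul, map_div₀, map_mul, ← Complex.exp_conj]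
  simp

lemma measureReal_gt_eq (a x : ℝ) :
    μ.real {ω | x < X ω} = Real.exp (-a * x) * expTail μ X a x := by
  rw [expTail, ← mul_assoc, ← Real.exp_add]
  simp

variable [IsProbabilityMeasure μ] {a : ℝ}

/-- The kernel is the Fourier transform of the weighted tail. -/
lemma lewisKernel_eq_integral (hX : Measurable X) (ha : 0 < a)
    (hI : Integrable (fun ω => Real.exp (a * X ω)) μ) (x u : ℝ) :
    lewisKernel (charFn μ X) a x u =
      ∫ y : ℝ, Complex.exp (Complex.I * u * ((y : ℂ) - x)) * (expTail μ X a y : ℂ) := by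
  rw [lewisKernel, charFn_sub_I_mul, mul_div_assoc,
    ← integral_exp_mul_tail hX (by simpa) (by simpa), ← integral_const_mul]
  congr with y
  rw [expTail, Complex.ofReal_mul, Complex.ofReal_exp, ← mul_assoc, ← mul_assoc, ← Complex.exp_add,
    ← Complex.exp_add]
  congr 2
  push_cast
  ring

lemma continuous_lewisKernel (hX : Measurable X) (ha : 0 < a)
    (hI : Integrable (fun ω => Real.exp (a * X ω)) μ) (x : ℝ) :
    Continuous (lewisKernel (charFn μ X) a x) := by
  have hG := integrable_expTail hX ha hI
  rw [show lewisKernel (charFn μ X) a x = _ from funext (lewisKernel_eq_integral hX ha hI x)]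
  refine continuous_of_dominated (bound := expTail μ X a) (fun u => ?_)
    (fun u => .of_forall fun y => ?_) hG (.of_forall fun y => by fun_prop)
  · exact (Continuous.aestronglyMeasurable (by fun_prop)).mul
      (Complex.continuous_ofReal.comp_aestronglyMeasurable hG.aestronglyMeasurable)
  · rw [norm_mul, Complex.norm_exp, Complex.norm_real, Real.norm_of_nonneg (expTail_nonneg a y)]
    simp

variable {B b w : ℝ}

lemma integrable_lewisKernel (hX : Measurable X) (ha : 0 < a)
    (hI : Integrable (fun ω => Real.exp (a * X ω)) μ) (hb : 0 < b) (hw : 0 < w)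
    (hdec : ∀ᶠ u : ℝ in atTop,
      ‖charFn μ X ((u : ℂ) - Complex.I * (a : ℂ))‖ < B * Real.exp (-b * u ^ w)) (x : ℝ) :
    Integrable (lewisKernel (charFn μ X) a x) := by
  -- The norm of the kernel is even, so decay at `+∞` controls both ends.
  refine (continuous_lewisKernel hX ha hI x).locallyIntegrable
    |>.integrable_of_isBigO_atTop_of_norm_isNegInvariant (.of_forall fun u => ?_)
    (isBigO_lewisKernel hb hw hdec x (-2)) ?_
  · simp only [Function.comp, lewisKernel_neg]
    exact (RCLike.norm_conj _).symm
  · exact ⟨Ioi 1, Ioi_mem_atTop 1, integrableOn_Ioi_rpow_of_lt (by norm_num) one_pos⟩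

lemma integral_lewisKernel (hX : Measurable X) (ha : 0 < a)
    (hI : Integrable (fun ω => Real.exp (a * X ω)) μ) (hb : 0 < b) (hw : 0 < w)
    (hdec : ∀ᶠ u : ℝ in atTop,
      ‖charFn μ X ((u : ℂ) - Complex.I * (a : ℂ))‖ < B * Real.exp (-b * u ^ w)) (x : ℝ) :
    ∫ u, lewisKernel (charFn μ X) a x u =
      ((2 * ∫ u in Ioi (0 : ℝ), lewisIntegrand (charFn μ X) a x u : ℝ) : ℂ) := by
  have hL := integrable_lewisKernel hX ha hI hb hw hdec x
  have h1 : ∫ u in Iic (0 : ℝ), lewisKernel (charFn μ X) a x u =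
      (starRingEnd ℂ) (∫ u in Ioi (0 : ℝ), lewisKernel (charFn μ X) a x u) := by
    rw [← integral_conj, ← neg_zero, ← integral_comp_neg_Ioi]
    simp only [lewisKernel_neg, neg_zero]
  have h2 : ∫ u in Ioi (0 : ℝ), lewisIntegrand (charFn μ X) a x u =
      (∫ u in Ioi (0 : ℝ), lewisKernel (charFn μ X) a x u).re := by
    have := integral_re (𝕜 := ℂ) (hL.integrableOn (s := Ioi 0))
    simpa only [RCLike.re_to_complex, lewisKernel_re] using this
  rw [← intervalIntegral.integral_Iic_add_Ioi hL.integrableOn hL.integrableOn (b := 0), h1, h2,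
    add_comm, Complex.add_conj]

/-- Fourier inversion for the weighted tail, valid at every point. -/
lemma expTail_eq_integral (hX : Measurable X) (ha : 0 < a)
    (hI : Integrable (fun ω => Real.exp (a * X ω)) μ) (hb : 0 < b) (hw : 0 < w)
    (hdec : ∀ᶠ u : ℝ in atTop,
      ‖charFn μ X ((u : ℂ) - Complex.I * (a : ℂ))‖ < B * Real.exp (-b * u ^ w)) (x : ℝ) :
    (expTail μ X a x : ℂ) = (2 * Real.pi : ℂ)⁻¹ * ∫ u, lewisKernel (charFn μ X) a x u := by
  have hG := integrable_expTail hX ha hI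
  have hL := integrable_lewisKernel hX ha hI hb hw hdec
  -- In the normalization `exp (-2πi y v)`, the frequency `v` corresponds to `u = -2πv`.
  have hF : ∀ v, FourierTransform.fourier (fun y => (expTail μ X a y : ℂ)) v =
      lewisKernel (charFn μ X) a 0 ((-(2 * Real.pi)) * v) := fun v => by
    rw [Real.fourier_real_eq_integral_exp_smul, lewisKernel_eq_integral hX ha hI]
    congr with y
    rw [smul_eq_mul]
    congr 2
    push_cast
    ring
  have hπ : -(2 * Real.pi) ≠ 0 := by simp [Real.pi_ne_zero]
  have hinv : ∀ x, ContinuousAt (expTail μ X a) x → (expTail μ X a x : ℂ) =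
      (2 * Real.pi : ℂ)⁻¹ * ∫ u, lewisKernel (charFn μ X) a x u := fun x hx => by
    have h1 := Integrable.fourierInv_fourier_eq (f := fun y => (expTail μ X a y : ℂ)) hG.ofReal
      (by
        rw [show FourierTransform.fourier (fun y => (expTail μ X a y : ℂ)) = _ from funext hF]
        exact (hL 0).comp_mul_left' hπ)
      (Complex.continuous_ofReal.continuousAt.comp hx)
    rw [← h1, Real.fourierInv_eq']
    have h2 : ∀ v : ℝ, Complex.exp (((2 * Real.pi * inner ℝ v x : ℝ) : ℂ) * Complex.I) •
        FourierTransform.fourier (fun y => (expTail μ X a y : ℂ)) v =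
        lewisKernel (charFn μ X) a x ((-(2 * Real.pi)) * v) := fun v => by
      rw [hF, lewisKernel, lewisKernel, smul_eq_mul, ← mul_div_assoc, ← mul_assoc,
        ← Complex.exp_add]
      congr 3
      simp only [RCLike.inner_apply, conj_trivial]
      push_cast
      ring
    simp_rw [h2]
    rw [Measure.integral_comp_mul_left (fun u => lewisKernel (charFn μ X) a x u), inv_neg, abs_neg,
      abs_of_pos (by positivity), Complex.real_smul]
    push_cast
    rfl
  have hcont := continuous_integral_lewisKernel hL
  -- Inversion holds so far only at continuity points of the tail. The inverse transform is
  -- continuous in `x`, which extends it to every point.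
  have hre := expTail_eq_of_continuous (μ := μ) hX a
    (g := fun x => ((2 * Real.pi : ℂ)⁻¹ * ∫ u, lewisKernel (charFn μ X) a x u).re)
    (Complex.continuous_re.comp (continuous_const.mul hcont))
    fun y hy => by rw [← hinv y hy, Complex.ofReal_re]
  rw [← congrFun hre x, integral_lewisKernel hX ha hI hb hw hdec]
  have : (2 * Real.pi : ℂ)⁻¹ = ((2 * Real.pi)⁻¹ : ℝ) := by push_cast; rfl
  rw [this, ← Complex.ofReal_mul, Complex.ofReal_re]

lemma expTail_eq_lewisIntegral (hX : Measurable X) (ha : 0 < a)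
    (hI : Integrable (fun ω => Real.exp (a * X ω)) μ) (hb : 0 < b) (hw : 0 < w)
    (hdec : ∀ᶠ u : ℝ in atTop,
      ‖charFn μ X ((u : ℂ) - Complex.I * (a : ℂ))‖ < B * Real.exp (-b * u ^ w)) (x : ℝ) :
    expTail μ X a x = Real.pi⁻¹ * ∫ u in Ioi (0 : ℝ), lewisIntegrand (charFn μ X) a x u := by
  have h := expTail_eq_integral hX ha hI hb hw hdec x
  rw [integral_lewisKernel hX ha hI hb hw hdec] at h
  have h' : expTail μ X a x =
      (2 * Real.pi)⁻¹ * (2 * ∫ u in Ioi (0 : ℝ), lewisIntegrand (charFn μ X) a x u) := by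
    exact_mod_cast h
  rw [h']
  field_simp

lemma continuous_expTail (hX : Measurable X) (ha : 0 < a)
    (hI : Integrable (fun ω => Real.exp (a * X ω)) μ) (hb : 0 < b) (hw : 0 < w)
    (hdec : ∀ᶠ u : ℝ in atTop,
      ‖charFn μ X ((u : ℂ) - Complex.I * (a : ℂ))‖ < B * Real.exp (-b * u ^ w)) :
    Continuous (expTail μ X a) := by
  have hL := integrable_lewisKernel hX ha hI hb hw hdec
  have hcont := continuous_integral_lewisKernel hL
  have h : expTail μ X a =
      fun x => ((2 * Real.pi : ℂ)⁻¹ * ∫ u, lewisKernel (charFn μ X) a x u).re := by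
    ext x
    rw [← expTail_eq_integral hX ha hI hb hw hdec, Complex.ofReal_re]
  rw [h]
  exact Complex.continuous_re.comp (continuous_const.mul hcont)

lemma integrableOn_lewisIntegrand (hX : Measurable X) (ha : 0 < a)
    (hI : Integrable (fun ω => Real.exp (a * X ω)) μ) (hb : 0 < b) (hw : 0 < w)
    (hdec : ∀ᶠ u : ℝ in atTop,
      ‖charFn μ X ((u : ℂ) - Complex.I * (a : ℂ))‖ < B * Real.exp (-b * u ^ w)) (x : ℝ) :
    IntegrableOn (lewisIntegrand (charFn μ X) a x) (Ioi 0) :=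
  (integrable_lewisKernel hX ha hI hb hw hdec x).re.integrableOn

lemma measureReal_le_eq_one_sub_expTail (hX : Measurable X) (a x : ℝ) :
    μ.real {ω | X ω ≤ x} = 1 - Real.exp (-a * x) * expTail μ X a x := by
  rw [← measureReal_gt_eq, ← probReal_compl_eq_one_sub (measurableSet_lt measurable_const hX)]
  congr 1
  ext ω
  simp

/-- The Lewis formula for the distribution function. -/
lemma measureReal_le_eq_lewisCDF (hX : Measurable X) (ha : 0 < a)
    (hI : Integrable (fun ω => Real.exp (a * X ω)) μ) (hb : 0 < b) (hw : 0 < w)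
    (hdec : ∀ᶠ u : ℝ in atTop,
      ‖charFn μ X ((u : ℂ) - Complex.I * (a : ℂ))‖ < B * Real.exp (-b * u ^ w)) (x : ℝ) :
    μ.real {ω | X ω ≤ x} = lewisCDF (charFn μ X) a x := by
  rw [measureReal_le_eq_one_sub_expTail hX a, expTail_eq_lewisIntegral hX ha hI hb hw hdec,
    lewisCDF]
  ring

end Random

/-! ### Alternating series, Poisson summation and the discretization error. -/

/-- An alternating series dominated by a geometric series is bounded by the odd part of the
latter. -/
lemma abs_tsum_alternating_le {v : ℕ → ℝ} {C r : ℝ} (hr0 : 0 ≤ r) (hr1 : r < 1)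
    (h0 : ∀ m, 0 ≤ v m) (hv : ∀ m, v m ≤ C * r ^ m) :
    Summable (fun m : ℕ => (-1 : ℝ) ^ (m + 1) * v (m + 1)) ∧
      |∑' m : ℕ, (-1 : ℝ) ^ (m + 1) * v (m + 1)| ≤ C * r / (1 - r ^ 2) := by
  have hC : 0 ≤ C := by simpa using (h0 0).trans (hv 0)
  have hr2 : r ^ 2 < 1 := by nlinarith
  have hsv : Summable v :=
    .of_nonneg_of_le h0 hv ((summable_geometric_of_lt_one hr0 hr1).mul_left C)
  have heven : Summable fun k : ℕ => v (2 * k + 2) :=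
    hsv.comp_injective fun i j hij => by simpa using hij
  have hodd : Summable fun k : ℕ => v (2 * k + 1) :=
    hsv.comp_injective fun i j hij => by simpa using hij
  have hgeo : HasSum (fun k : ℕ => (r ^ 2) ^ k) (1 - r ^ 2)⁻¹ :=
    hasSum_geometric_of_lt_one (by positivity) hr2
  have he : ∑' k : ℕ, v (2 * k + 2) ≤ C * r ^ 2 * (1 - r ^ 2)⁻¹ := by
    refine hasSum_le (fun k => ?_) heven.hasSum (hgeo.mul_left _)
    calc v (2 * k + 2) ≤ C * r ^ (2 * k + 2) := hv _
      _ = C * r ^ 2 * (r ^ 2) ^ k := by ring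
  have ho : ∑' k : ℕ, v (2 * k + 1) ≤ C * r * (1 - r ^ 2)⁻¹ := by
    refine hasSum_le (fun k => ?_) hodd.hasSum (hgeo.mul_left _)
    calc v (2 * k + 1) ≤ C * r ^ (2 * k + 1) := hv _
      _ = C * r * (r ^ 2) ^ k := by ring
  -- The alternating sum is a difference of two nonnegative sums, so the larger of their bounds
  -- suffices; as `r ≤ 1`, that is the odd one.
  have he' : C * r ^ 2 * (1 - r ^ 2)⁻¹ ≤ C * r * (1 - r ^ 2)⁻¹ := by
    refine mul_le_mul_of_nonneg_right ?_ (inv_nonneg.2 (by linarith))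
    exact mul_le_mul_of_nonneg_left (by nlinarith) hC
  have he0 : 0 ≤ ∑' k : ℕ, v (2 * k + 2) := tsum_nonneg fun k => h0 _
  have ho0 : 0 ≤ ∑' k : ℕ, v (2 * k + 1) := tsum_nonneg fun k => h0 _
  have hE : ∀ k : ℕ, (-1 : ℝ) ^ (2 * k + 1) * v (2 * k + 1) = -v (2 * k + 1) := fun k => by
    simp [pow_add, pow_mul]
  have hO : ∀ k : ℕ, (-1 : ℝ) ^ (2 * k + 1 + 1) * v (2 * k + 1 + 1) = v (2 * k + 2) := fun k => by
    simp [pow_add, pow_mul]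
  have hsum := HasSum.even_add_odd (f := fun m : ℕ => (-1 : ℝ) ^ (m + 1) * v (m + 1))
    (by simpa only [hE] using hodd.hasSum.neg) (by simpa only [hO] using heven.hasSum)
  refine ⟨hsum.summable, ?_⟩
  rw [hsum.tsum_eq, abs_le, div_eq_mul_inv]
  constructor <;> linarith

section Poisson

variable {Ω : Type*} [MeasurableSpace Ω] {μ : Measure Ω} {X : Ω → ℝ}

/-- The tail, transported to the scale of the Poisson summation and modulated so that the Fourier
transform is sampled at the midpoints. -/
noncomputable def modulatedTail (μ : Measure Ω) (X : Ω → ℝ) (a x c y : ℝ) : ℂ :=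
  Complex.exp (-(Complex.I * Real.pi * y)) * (expTail μ X a (x - c * y) : ℂ)

lemma norm_modulatedTail (a x c y : ℝ) :
    ‖modulatedTail μ X a x c y‖ = expTail μ X a (x - c * y) := by
  rw [modulatedTail, norm_mul, Complex.norm_exp, Complex.norm_real,
    Real.norm_of_nonneg (expTail_nonneg _ _)]
  simp

/-- At integers the modulation is a sign, the source of the alternation. -/
lemma modulatedTail_natCast (a x c : ℝ) (m : ℕ) :
    modulatedTail μ X a x c (m : ℝ) = (((-1 : ℝ) ^ m * expTail μ X a (x - c * m) : ℝ) : ℂ) := by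
  have : -(Complex.I * Real.pi * (m : ℝ)) = (m : ℂ) * -(Real.pi * Complex.I) := by push_cast; ring
  rw [modulatedTail, this, Complex.exp_nat_mul, Complex.exp_neg, Complex.exp_pi_mul_I]
  push_cast
  norm_num

lemma modulatedTail_neg_natCast (a x c : ℝ) (m : ℕ) :
    modulatedTail μ X a x c (-(m : ℝ)) = (((-1 : ℝ) ^ m * expTail μ X a (x + c * m) : ℝ) : ℂ) := by
  have : -(Complex.I * Real.pi * ((-(m : ℝ) : ℝ) : ℂ)) = (m : ℂ) * (Real.pi * Complex.I) := by
    push_cast; ring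
  rw [modulatedTail, this, Complex.exp_nat_mul, Complex.exp_pi_mul_I]
  push_cast
  norm_num

variable [IsProbabilityMeasure μ] {a B b w : ℝ}

lemma summable_lewisKernel {φ : ℂ → ℂ} (hb : 0 < b) (hw : 0 < w)
    (hdec : ∀ᶠ u : ℝ in atTop,
      ‖φ ((u : ℂ) - Complex.I * (a : ℂ))‖ < B * Real.exp (-b * u ^ w)) {h : ℝ} (hh : 0 < h)
    (x : ℝ) : Summable fun l : ℕ => lewisKernel φ a x (((l : ℝ) + 1 / 2) * h) := by
  have ht : Tendsto (fun l : ℕ => ((l : ℝ) + 1 / 2) * h) atTop atTop :=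
    (tendsto_atTop_add_const_right _ _ tendsto_natCast_atTop_atTop).atTop_mul_const hh
  refine summable_of_isBigO_nat (Real.summable_nat_rpow.2 (by norm_num : (-2 : ℝ) < -1))
    (((isBigO_lewisKernel hb hw hdec x (-2)).comp_tendsto ht).trans (.of_bound (h ^ (-2 : ℝ)) ?_))
  filter_upwards [eventually_ge_atTop 1] with l hl
  have hl' : (0 : ℝ) < l := by exact_mod_cast hl
  rw [Function.comp, Real.norm_of_nonneg (by positivity), Real.norm_of_nonneg (by positivity),
    Real.mul_rpow (by positivity) hh.le, mul_comm]
  exact mul_le_mul_of_nonneg_left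
    (Real.rpow_le_rpow_of_nonpos hl' (by linarith) (by norm_num)) (by positivity)

/-- Substitute `z = x - (2π/h) y`: the factor `exp (-iπy)` shifts the frequency `v` to `v + 1/2`, so
integers land on the midpoints, and `h / (2π)` is the Jacobian. -/
lemma fourier_modulatedTail (hX : Measurable X) (ha : 0 < a)
    (hI : Integrable (fun ω => Real.exp (a * X ω)) μ) {h : ℝ} (hh : 0 < h) (x v : ℝ) :
    FourierTransform.fourier (modulatedTail μ X a x (2 * Real.pi / h)) v =
      ((h / (2 * Real.pi) : ℝ) : ℂ) * lewisKernel (charFn μ X) a x ((v + 1 / 2) * h) := by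
  rw [Real.fourier_real_eq_integral_exp_smul, lewisKernel_eq_integral hX ha hI]
  set k : ℝ → ℂ := fun z =>
    Complex.exp (Complex.I * (((v + 1 / 2) * h : ℝ) : ℂ) * ((z : ℂ) - x)) * (expTail μ X a z : ℂ)
    with hk
  have hh' : (h : ℂ) ≠ 0 := by exact_mod_cast hh.ne'
  have h1 : ∀ y : ℝ, Complex.exp (((-2 * Real.pi * y * v : ℝ) : ℂ) * Complex.I) •
      modulatedTail μ X a x (2 * Real.pi / h) y = k (x - 2 * Real.pi / h * y) := fun y => by
    rw [modulatedTail, smul_eq_mul, ← mul_assoc, ← Complex.exp_add, hk]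
    congr 2
    push_cast
    field_simp
    ring
  simp_rw [h1]
  rw [Measure.integral_comp_mul_left (fun y => k (x - y)), integral_sub_left_eq_self k,
    inv_div, abs_of_pos (by positivity), Complex.real_smul]

/-- Decay hypothesis of Poisson summation. As `y → -∞` the tail is evaluated near `+∞` and a moment
of order `p > a` is needed; as `y → +∞` the bound `P ≤ 1` suffices. -/
lemma isBigO_modulatedTail {p : ℝ} (ha : 0 < a) (hp : a < p)
    (hI : Integrable (fun ω => Real.exp (p * X ω)) μ) {c : ℝ} (hc : 0 < c) (x : ℝ) :
    modulatedTail μ X a x c =O[cocompact ℝ] fun y : ℝ => |y| ^ (-2 : ℝ) := by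
  have key : ∀ d : ℝ, 0 < d → ∀ C : ℝ,
      (fun y : ℝ => C * Real.exp (-d * y)) =O[atTop] fun y : ℝ => |y| ^ (-2 : ℝ) := fun d hd C => by
    refine ((isLittleO_exp_neg_mul_rpow_atTop hd (-2)).isBigO.const_mul_left C).congr' .rfl ?_
    filter_upwards [eventually_ge_atTop 0] with y hy
    rw [abs_of_nonneg hy]
  rw [cocompact_eq_atBot_atTop, isBigO_sup]
  constructor
  · have h1 := (key ((p - a) * c) (mul_pos (by linarith) hc)
      (Real.exp ((a - p) * x) * mgf X μ p)).comp_tendsto tendsto_neg_atBot_atTop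
    refine IsBigO.trans (.of_bound 1 (.of_forall fun y => ?_))
      (h1.congr_right fun y => by simp [Function.comp])
    rw [norm_modulatedTail, one_mul, Function.comp]
    refine (expTail_le_exp_mul_mgf (ha.trans hp).le hI a _).trans (le_trans (le_of_eq ?_)
      (Real.le_norm_self _))
    rw [mul_right_comm, ← Real.exp_add]
    congr 2
    ring
  · refine IsBigO.trans (.of_bound 1 (.of_forall fun y => ?_))
      (key (a * c) (mul_pos ha hc) (Real.exp (a * x)))
    rw [norm_modulatedTail, one_mul]
    refine (expTail_le_exp a _).trans (le_trans (le_of_eq ?_) (Real.le_norm_self _))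
    rw [← Real.exp_add]
    congr 1
    ring

/-- Poisson summation for the weighted tail: the midpoint sum of the Lewis integrand. -/
lemma tsum_modulatedTail (hX : Measurable X) (ha : 0 < a)
    (hI : Integrable (fun ω => Real.exp (a * X ω)) μ) {p : ℝ} (hp : a < p)
    (hIp : Integrable (fun ω => Real.exp (p * X ω)) μ) (hb : 0 < b) (hw : 0 < w)
    (hdec : ∀ᶠ u : ℝ in atTop,
      ‖charFn μ X ((u : ℂ) - Complex.I * (a : ℂ))‖ < B * Real.exp (-b * u ^ w))
    {h : ℝ} (hh : 0 < h) (x : ℝ) :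
    ∑' n : ℤ, modulatedTail μ X a x (2 * Real.pi / h) n =
      ((h / Real.pi * ∑' l : ℕ, lewisIntegrand (charFn μ X) a x (((l : ℝ) + 1 / 2) * h) : ℝ) :
        ℂ) := by
  set c := 2 * Real.pi / h
  have hL := summable_lewisKernel (φ := charFn μ X) hb hw hdec hh x
  have hF : ∀ n : ℤ, FourierTransform.fourier (modulatedTail μ X a x c) (n : ℝ) =
      ((h / (2 * Real.pi) : ℝ) : ℂ) * lewisKernel (charFn μ X) a x (((n : ℝ) + 1 / 2) * h) :=
    fun n => fourier_modulatedTail hX ha hI hh x n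
  have hpos : (fun n : ℕ => lewisKernel (charFn μ X) a x ((((n : ℤ) : ℝ) + 1 / 2) * h)) =
      fun l : ℕ => lewisKernel (charFn μ X) a x (((l : ℝ) + 1 / 2) * h) := by
    simp
  -- The index `-(l + 1)` gives the frequency `-(l + 1/2) h`, the mirror image of the midpoint of
  -- index `l`.
  have hneg : (fun n : ℕ => lewisKernel (charFn μ X) a x ((((-((n : ℤ) + 1) : ℤ) : ℝ) + 1 / 2) * h))
      = fun l : ℕ => (starRingEnd ℂ) (lewisKernel (charFn μ X) a x (((l : ℝ) + 1 / 2) * h)) := by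
    ext l
    rw [← lewisKernel_neg]
    congr 1
    push_cast
    ring
  have hLneg : Summable fun l : ℕ =>
      (starRingEnd ℂ) (lewisKernel (charFn μ X) a x (((l : ℝ) + 1 / 2) * h)) :=
    .of_norm (by simpa only [RCLike.norm_conj] using hL.norm)
  have hsum : Summable fun n : ℤ => lewisKernel (charFn μ X) a x (((n : ℝ) + 1 / 2) * h) :=
    .of_nat_of_neg_add_one (by rw [hpos]; exact hL) (by rw [hneg]; exact hLneg)
  have hcont : Continuous (modulatedTail μ X a x c) := by
    have := continuous_expTail hX ha hI hb hw hdec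
    unfold modulatedTail
    fun_prop
  have hP := Real.tsum_eq_tsum_fourier_of_rpow_decay_of_summable hcont one_lt_two
    (isBigO_modulatedTail ha hp hIp (by positivity) x)
    (by simp_rw [hF]; exact hsum.mul_left _) 0
  simp only [zero_add, QuotientAddGroup.mk_zero, fourier_eval_zero, mul_one, hF] at hP
  rw [hP, tsum_mul_left, tsum_of_nat_of_neg_add_one (by rw [hpos]; exact hL)
    (by rw [hneg]; exact hLneg), hpos, hneg, ← Complex.conj_tsum, Complex.add_conj,
    Complex.re_tsum hL]
  simp only [lewisKernel_re]
  rw [← Complex.ofReal_mul]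
  congr 1
  rw [← mul_assoc]
  congr 1
  field_simp

/-- Discretization error of the midpoint rule for the Lewis formula, without truncation. -/
lemma abs_tsum_lewisIntegrand_sub_le (hX : Measurable X) (ha : 0 < a)
    (hI : Integrable (fun ω => Real.exp (a * X ω)) μ) {p : ℝ} (hp : a < p)
    (hIp : Integrable (fun ω => Real.exp (p * X ω)) μ) (hb : 0 < b) (hw : 0 < w)
    (hdec : ∀ᶠ u : ℝ in atTop,
      ‖charFn μ X ((u : ℂ) - Complex.I * (a : ℂ))‖ < B * Real.exp (-b * u ^ w))
    {h : ℝ} (hh : 0 < h) (x : ℝ) :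
    |Real.exp (-a * x) * (h / Real.pi *
        ∑' l : ℕ, lewisIntegrand (charFn μ X) a x (((l : ℝ) + 1 / 2) * h)) -
      μ.real {ω | x < X ω}| ≤ discError (charFn μ X) a p h x := by
  set c := 2 * Real.pi / h with hc
  have hc0 : 0 < c := by positivity
  have hE : ∀ y, Real.exp (-a * x) * Real.exp y = Real.exp (y - a * x) := fun y => by
    rw [← Real.exp_add]; ring_nf
  obtain ⟨hs1, hb1⟩ := abs_tsum_alternating_le (C := 1)
    (v := fun m : ℕ => Real.exp (-a * x) * expTail μ X a (x - c * m)) (r := Real.exp (-(a * c)))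
    (Real.exp_pos _).le (Real.exp_lt_one_iff.2 (by nlinarith [mul_pos ha hc0]))
    (fun m => mul_nonneg (Real.exp_pos _).le (expTail_nonneg _ _)) (fun m => by
      refine (mul_le_mul_of_nonneg_left (expTail_le_exp a _) (Real.exp_pos _).le).trans
        (le_of_eq ?_)
      rw [hE, one_mul, ← Real.exp_nat_mul]
      ring_nf)
  obtain ⟨hs2, hb2⟩ := abs_tsum_alternating_le (C := Real.exp (-p * x) * mgf X μ p)
    (v := fun m : ℕ => Real.exp (-a * x) * expTail μ X a (x + c * m))
    (r := Real.exp (-((p - a) * c)))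
    (Real.exp_pos _).le (Real.exp_lt_one_iff.2 (by nlinarith [mul_pos (sub_pos.2 hp) hc0]))
    (fun m => mul_nonneg (Real.exp_pos _).le (expTail_nonneg _ _)) (fun m => by
      refine (mul_le_mul_of_nonneg_left (expTail_le_exp_mul_mgf (ha.trans hp).le hIp a _)
        (Real.exp_pos _).le).trans (le_of_eq ?_)
      rw [← mul_assoc, hE, mul_right_comm, ← Real.exp_nat_mul, ← Real.exp_add]
      ring_nf)
  have hexp : Real.exp (-a * x) ≠ 0 := (Real.exp_pos _).ne'
  have hs1' : Summable fun m : ℕ => (-1 : ℝ) ^ (m + 1) * expTail μ X a (x - c * (m + 1 : ℕ)) := by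
    rw [← summable_mul_left_iff hexp]
    exact hs1.congr fun m => by ring
  have hs2' : Summable fun m : ℕ => (-1 : ℝ) ^ (m + 1) * expTail μ X a (x + c * (m + 1 : ℕ)) := by
    rw [← summable_mul_left_iff hexp]
    exact hs2.congr fun m => by ring
  have hmt1 : ∀ n : ℕ, modulatedTail μ X a x c ((n : ℤ) : ℝ) =
      (((-1 : ℝ) ^ n * expTail μ X a (x - c * n) : ℝ) : ℂ) := fun n => by
    rw [← modulatedTail_natCast]; simp
  have hmt2 : ∀ n : ℕ, modulatedTail μ X a x c ((-((n : ℤ) + 1) : ℤ) : ℝ) =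
      (((-1 : ℝ) ^ (n + 1) * expTail μ X a (x + c * (n + 1 : ℕ)) : ℝ) : ℂ) := fun n => by
    rw [← modulatedTail_neg_natCast]; push_cast; rfl
  have hs0 : Summable fun m : ℕ => (-1 : ℝ) ^ m * expTail μ X a (x - c * m) :=
    (summable_nat_add_iff 1).1 hs1'
  have hP := tsum_modulatedTail hX ha hI hp hIp hb hw hdec hh x
  rw [← hc, tsum_of_nat_of_neg_add_one
    (by simp_rw [hmt1]; exact Complex.summable_ofReal.2 hs0)
    (by simp_rw [hmt2]; exact Complex.summable_ofReal.2 hs2')] at hP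
  simp_rw [hmt1, hmt2] at hP
  rw [← Complex.ofReal_tsum, ← Complex.ofReal_tsum, ← Complex.ofReal_add, Complex.ofReal_inj,
    hs0.tsum_eq_zero_add] at hP
  have h1 : Real.exp (-a * x) * ∑' m : ℕ, (-1 : ℝ) ^ (m + 1) * expTail μ X a (x - c * (m + 1 : ℕ)) =
      ∑' m : ℕ, (-1 : ℝ) ^ (m + 1) * (Real.exp (-a * x) * expTail μ X a (x - c * (m + 1 : ℕ))) := by
    rw [← tsum_mul_left]
    exact tsum_congr fun m => by ring
  have h2 : Real.exp (-a * x) * ∑' m : ℕ, (-1 : ℝ) ^ (m + 1) * expTail μ X a (x + c * (m + 1 : ℕ)) =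
      ∑' m : ℕ, (-1 : ℝ) ^ (m + 1) * (Real.exp (-a * x) * expTail μ X a (x + c * (m + 1 : ℕ))) := by
    rw [← tsum_mul_left]
    exact tsum_congr fun m => by ring
  rw [← hP, measureReal_gt_eq a]
  -- The term of index `0` cancels the exact tail, leaving the two one-sided alternating sums.
  have hsplit : ∀ G S T : ℝ, Real.exp (-a * x) * ((-1 : ℝ) ^ 0 * G + S + T) -
      Real.exp (-a * x) * G = Real.exp (-a * x) * S + Real.exp (-a * x) * T := fun G S T => by ring
  simp only [Nat.cast_zero, mul_zero, sub_zero]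
  rw [hsplit, h1, h2]
  refine (abs_add_le _ _).trans ((add_le_add hb1 hb2).trans (le_of_eq ?_))
  rw [discError, charFn_neg_I_mul_re, ← Real.exp_nat_mul, ← Real.exp_nat_mul]
  have e1 : -(a * c) = -2 * Real.pi * a / h := by rw [hc]; ring
  have e2 : ((2 : ℕ) : ℝ) * (-2 * Real.pi * a / h) = -4 * Real.pi * a / h := by push_cast; ring
  have e3 : -((p - a) * c) = -2 * Real.pi * (p - a) / h := by rw [hc]; ring
  have e4 : ((2 : ℕ) : ℝ) * (-2 * Real.pi * (p - a) / h) = -4 * Real.pi * (p - a) / h := by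
    push_cast; ring
  have e5 : Real.exp (-2 * Real.pi * (p - a) / h - p * x) =
      Real.exp (-p * x) * Real.exp (-2 * Real.pi * (p - a) / h) := by
    rw [← Real.exp_add]; ring_nf
  rw [e1, e2, e3, e4, e5]
  ring

end Poisson

/-! ### Truncation error. -/

/-- Hermite–Hadamard, left inequality: the midpoint rule underestimates a convex function. -/
lemma midpoint_mul_le_integral {g : ℝ → ℝ} {c h : ℝ} (hh : 0 ≤ h)
    (hg : ConvexOn ℝ (Icc c (c + h)) g) (hc : ContinuousOn g (Icc c (c + h))) :
    g (c + h / 2) * h ≤ ∫ u in c..c + h, g u := by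
  have hle : c ≤ c + h := by linarith
  have hi : IntervalIntegrable g volume c (c + h) := hc.intervalIntegrable_of_Icc hle
  -- Reflection about the midpoint preserves the integral, and by convexity the average of `g` over
  -- a reflected pair is at least its midpoint value.
  have hrefl : ∫ u in c..c + h, g (2 * c + h - u) = ∫ u in c..c + h, g u := by
    rw [intervalIntegral.integral_comp_sub_left (fun u => g u)]
    ring_nf
  have hi' : IntervalIntegrable (fun u => g (2 * c + h - u)) volume c (c + h) := by
    refine ContinuousOn.intervalIntegrable_of_Icc hle (hc.comp (by fun_prop) fun u hu => ?_)
    constructor <;> linarith [hu.1, hu.2]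
  have hmono : ∫ _ in c..c + h, 2 * g (c + h / 2) ≤
      ∫ u in c..c + h, (g u + g (2 * c + h - u)) := by
    refine intervalIntegral.integral_mono_on hle intervalIntegrable_const (hi.add hi')
      fun u hu => ?_
    have hu' : 2 * c + h - u ∈ Icc c (c + h) := by constructor <;> linarith [hu.1, hu.2]
    have := hg.2 hu hu' (by norm_num : (0 : ℝ) ≤ 1 / 2) (by norm_num : (0 : ℝ) ≤ 1 / 2)
      (by norm_num)
    simp only [smul_eq_mul] at this
    rw [show (1 : ℝ) / 2 * u + 1 / 2 * (2 * c + h - u) = c + h / 2 by ring] at this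
    linarith
  rw [intervalIntegral.integral_add hi hi', hrefl, intervalIntegral.integral_const,
    smul_eq_mul] at hmono
  linarith

lemma continuousOn_exp_neg_mul_rpow (b w : ℝ) {U : ℝ} (hU : 0 < U) :
    ContinuousOn (fun u : ℝ => Real.exp (-b * u ^ w)) (Ici U) := by
  refine Real.continuous_exp.comp_continuousOn (continuousOn_const.mul ?_)
  exact ContinuousOn.rpow_const continuousOn_id fun u hu => .inl (hU.trans_le hu).ne'

/-- A stretched exponential is eventually convex. -/
lemma eventually_convexOn_exp_neg_mul_rpow {b w : ℝ} (hb : 0 < b) (hw : 0 < w) :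
    ∀ᶠ U : ℝ in atTop, ConvexOn ℝ (Ici U) fun u : ℝ => Real.exp (-b * u ^ w) := by
  have ht : Tendsto (fun u : ℝ => b * w * u ^ w) atTop atTop :=
    (tendsto_rpow_atTop hw).const_mul_atTop (by positivity)
  -- The second derivative has the sign of `b w u^w - (w - 1)`.
  obtain ⟨U₀, hU₀⟩ := eventually_atTop.1 (ht.eventually_ge_atTop (w - 1))
  filter_upwards [eventually_ge_atTop U₀, eventually_gt_atTop 0] with U hU hU0
  have h1 : ∀ u : ℝ, 0 < u → HasDerivAt (fun u : ℝ => Real.exp (-b * u ^ w))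
      (Real.exp (-b * u ^ w) * (-b * (w * u ^ (w - 1)))) u := fun u hu =>
    ((Real.hasDerivAt_rpow_const (.inl hu.ne')).const_mul (-b)).exp
  have h2 : ∀ u : ℝ, 0 < u → HasDerivAt
      (fun u : ℝ => Real.exp (-b * u ^ w) * (-b * (w * u ^ (w - 1))))
      (Real.exp (-b * u ^ w) * (-b * (w * u ^ (w - 1))) * (-b * (w * u ^ (w - 1))) +
        Real.exp (-b * u ^ w) * (-b * (w * ((w - 1) * u ^ (w - 1 - 1))))) u := fun u hu =>
    (h1 u hu).mul
      (((Real.hasDerivAt_rpow_const (.inl hu.ne')).const_mul w).const_mul (-b))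
  refine convexOn_of_hasDerivWithinAt2_nonneg (convex_Ici U)
    (continuousOn_exp_neg_mul_rpow b w hU0)
    (fun u hu => (h1 u ?_).hasDerivWithinAt) (fun u hu => (h2 u ?_).hasDerivWithinAt)
    fun u hu => ?_
  · rw [interior_Ici] at hu; exact hU0.trans hu
  · rw [interior_Ici] at hu; exact hU0.trans hu
  · rw [interior_Ici] at hu
    have hu0 : 0 < u := hU0.trans hu
    have hsq : u ^ (w - 1) * u ^ (w - 1) = u ^ (w - 1 - 1) * u ^ w := by
      rw [← Real.rpow_add hu0, ← Real.rpow_add hu0]; ring_nf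
    have hkey := hU₀ u (hU.trans (le_of_lt hu))
    have : Real.exp (-b * u ^ w) * (-b * (w * u ^ (w - 1))) * (-b * (w * u ^ (w - 1))) +
        Real.exp (-b * u ^ w) * (-b * (w * ((w - 1) * u ^ (w - 1 - 1)))) =
        Real.exp (-b * u ^ w) * (b * w * u ^ (w - 1 - 1)) * (b * w * u ^ w - (w - 1)) := by
      linear_combination (Real.exp (-b * u ^ w) * b ^ 2 * w ^ 2) * hsq
    rw [this]
    exact mul_nonneg (by positivity) (by linarith)

lemma integrableOn_exp_neg_mul_rpow {b w : ℝ} (hb : 0 < b) (hw : 0 < w) {y : ℝ} (hy : 0 ≤ y) :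
    IntegrableOn (fun u : ℝ => Real.exp (-b * u ^ w)) (Ioi y) := by
  have := integrableOn_rpow_mul_exp_neg_mul_rpow (s := 0) (by norm_num) hw hb
  simp only [Real.rpow_zero, one_mul] at this
  exact this.mono_set (Ioi_subset_Ioi hy)

/-- The tail integral of a stretched exponential in terms of the incomplete gamma function. -/
lemma integral_Ioi_exp_neg_mul_rpow {b w : ℝ} (hb : 0 < b) (hw : 0 < w) {y : ℝ} (hy : 0 < y) :
    ∫ u in Ioi y, Real.exp (-b * u ^ w) =
      (w * b ^ (1 / w))⁻¹ * upperGamma (1 / w) (b * y ^ w) := by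
  have hne : w * b ^ (1 / w) ≠ 0 := by positivity
  have hpt : ∀ u : ℝ, 0 < u →
      -- Change of variable `r = b u^w`: the powers of `u` cancel, since `w (1/w - 1) + (w - 1) =
      -- 0`.
      (b * u ^ w) ^ (1 / w - 1) * Real.exp (-(b * u ^ w)) * (b * (w * u ^ (w - 1))) =
        w * b ^ (1 / w) * Real.exp (-b * u ^ w) := fun u hu => by
    rw [Real.mul_rpow hb.le (by positivity), ← Real.rpow_mul hu.le, Real.rpow_sub_one hb.ne',
      neg_mul]
    have : u ^ (w * (1 / w - 1)) * u ^ (w - 1) = 1 := by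
      rw [← Real.rpow_add hu, show w * (1 / w - 1) + (w - 1) = 0 by field_simp; ring,
        Real.rpow_zero]
    calc b ^ (1 / w) / b * u ^ (w * (1 / w - 1)) * Real.exp (-(b * u ^ w)) *
          (b * (w * u ^ (w - 1)))
        = b ^ (1 / w) * w * Real.exp (-(b * u ^ w)) * (u ^ (w * (1 / w - 1)) * u ^ (w - 1)) := by
          field_simp
      _ = w * b ^ (1 / w) * Real.exp (-(b * u ^ w)) := by rw [this]; ring
  have hderiv : ∀ u : ℝ, 0 < u → HasDerivAt (fun u : ℝ => b * u ^ w) (b * (w * u ^ (w - 1))) u :=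
    fun u hu => (Real.hasDerivAt_rpow_const (.inl hu.ne')).const_mul b
  have himg : (fun u : ℝ => b * u ^ w) '' Ici y ⊆ Ioi 0 := by
    rintro _ ⟨u, hu, rfl⟩
    exact mul_pos hb (Real.rpow_pos_of_pos (hy.trans_le hu) _)
  have hcv := integral_comp_mul_deriv_Ioi (f := fun u : ℝ => b * u ^ w)
    (f' := fun u => b * (w * u ^ (w - 1))) (g := fun r => r ^ (1 / w - 1) * Real.exp (-r)) (a := y)
    (fun u hu => (hderiv u (hy.trans_le hu)).continuousAt.continuousWithinAt)
    ((tendsto_rpow_atTop hw).const_mul_atTop hb)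
    (fun u hu => (hderiv u (hy.trans hu)).hasDerivWithinAt)
    (fun r hr => by
      have hr0 : r ≠ 0 := ne_of_gt (himg (image_mono Ioi_subset_Ici_self hr))
      exact ((Real.continuousAt_rpow_const _ _ (.inl hr0)).mul
        (by fun_prop)).continuousWithinAt)
    (((Real.GammaIntegral_convergent (s := 1 / w) (by positivity)).congr_fun
      (fun r _ => mul_comm _ _) measurableSet_Ioi).mono_set himg)
    (by
      rw [integrableOn_Ici_iff_integrableOn_Ioi]
      have h := (integrableOn_exp_neg_mul_rpow hb hw hy.le).const_mul (w * b ^ (1 / w))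
      exact IntegrableOn.congr_fun h (fun u hu => (hpt u (hy.trans hu)).symm) measurableSet_Ioi)
  rw [upperGamma, ← hcv]
  simp only [Function.comp]
  rw [setIntegral_congr_fun measurableSet_Ioi (fun u hu => hpt u (hy.trans hu)),
    integral_const_mul, inv_mul_cancel_left₀ hne]

/-- Midpoint sums of an eventually convex stretched exponential are bounded by its tail
integral. -/
lemma sum_exp_neg_mul_rpow_le {b w : ℝ} (hb : 0 < b) (hw : 0 < w) {h y : ℝ} (hh : 0 < h)
    (hy : 0 < y) (hconv : ConvexOn ℝ (Ici y) fun u : ℝ => Real.exp (-b * u ^ w)) (n : ℕ) :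
    ∑ l ∈ Finset.range n, Real.exp (-b * (y + l * h + h / 2) ^ w) * h ≤
      ∫ u in Ioi y, Real.exp (-b * u ^ w) := by
  have hcont := continuousOn_exp_neg_mul_rpow b w hy
  have hsub : ∀ l : ℕ, Icc (y + l * h) (y + l * h + h) ⊆ Ici y := fun l u hu =>
    mem_Ici.2 (le_trans (by nlinarith [mul_nonneg (Nat.cast_nonneg (α := ℝ) l) hh.le]) hu.1)
  have hstep : ∀ l : ℕ, y + l * h + h = y + (l + 1 : ℕ) * h := fun l => by push_cast; ring
  calc ∑ l ∈ Finset.range n, Real.exp (-b * (y + l * h + h / 2) ^ w) * h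
      ≤ ∑ l ∈ Finset.range n, ∫ u in y + l * h..y + (l + 1 : ℕ) * h,
          Real.exp (-b * u ^ w) := Finset.sum_le_sum fun l _ => by
        rw [← hstep]
        exact midpoint_mul_le_integral (g := fun u : ℝ => Real.exp (-b * u ^ w)) hh.le
          (hconv.subset (hsub l) (convex_Icc _ _)) (hcont.mono (hsub l))
    _ = ∫ u in y..y + n * h, Real.exp (-b * u ^ w) := by
        have := intervalIntegral.sum_integral_adjacent_intervals (μ := volume) (n := n)
          (f := fun u : ℝ => Real.exp (-b * u ^ w)) (a := fun l : ℕ => y + l * h)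
          fun l _ => by
            rw [← hstep]
            exact (hcont.mono (hsub l)).intervalIntegrable_of_Icc (by linarith)
        simpa using this
    _ ≤ ∫ u in Ioi y, Real.exp (-b * u ^ w) := by
        rw [intervalIntegral.integral_of_le
          (by nlinarith [mul_nonneg (Nat.cast_nonneg (α := ℝ) n) hh.le])]
        exact setIntegral_mono_set (integrableOn_exp_neg_mul_rpow hb hw hy.le)
          (.of_forall fun u => (Real.exp_pos _).le) Ioc_subset_Ioi_self.eventuallyLE

/-- Truncation error of the midpoint rule for the Lewis formula. -/
lemma abs_tsum_lewisIntegrand_le {φ : ℂ → ℂ} {a B b w h : ℝ} (hb : 0 < b)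
    (hw : 0 < w) (hh : 0 < h) {N : ℕ} (hN : 0 < N * h)
    (hconv : ConvexOn ℝ (Ici (N * h)) fun u : ℝ => Real.exp (-b * u ^ w))
    (hdec : ∀ u : ℝ, N * h ≤ u →
      ‖φ ((u : ℂ) - Complex.I * (a : ℂ))‖ < B * Real.exp (-b * u ^ w)) (x : ℝ) :
    Real.exp (-a * x) * (h / Real.pi *
      |∑' l : ℕ, lewisIntegrand φ a x ((((l + N : ℕ) : ℝ) + 1 / 2) * h)|) ≤
        rangeError a B b w (N * h) x := by
  set y := (N : ℝ) * h with hy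
  set e : ℕ → ℝ := fun l => Real.exp (-b * (y + l * h + h / 2) ^ w) * h
  have he0 : ∀ l, 0 ≤ e l := fun l => by positivity
  have hpart := sum_exp_neg_mul_rpow_le hb hw hh hN hconv
  have hes : Summable e := summable_of_sum_range_le he0 hpart
  have het : ∑' l, e l ≤ (w * b ^ (1 / w))⁻¹ * upperGamma (1 / w) (b * y ^ w) := by
    rw [← integral_Ioi_exp_neg_mul_rpow hb hw hN]
    exact Real.tsum_le_of_sum_range_le he0 hpart
  have hB : 0 < B :=
    pos_of_mul_pos_left ((norm_nonneg _).trans_lt (hdec y le_rfl)) (Real.exp_pos _).le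
  -- Bounding `1/u` by `1/y` gives the factor `1/(N h)` of the range term; the extra `1/h` offsets
  -- the step included in `e`.
  have hbound : ∀ l : ℕ, ‖lewisIntegrand φ a x ((((l + N : ℕ) : ℝ) + 1 / 2) * h)‖ ≤
      B / (y * h) * e l := fun l => by
    have hu : (((l + N : ℕ) : ℝ) + 1 / 2) * h = y + l * h + h / 2 := by
      rw [hy]; push_cast; ring
    have hyu : y ≤ y + l * h + h / 2 := by
      have := mul_nonneg (Nat.cast_nonneg (α := ℝ) l) hh.le
      linarith
    rw [hu, ← lewisKernel_re]
    refine (Complex.abs_re_le_norm _).trans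
      ((norm_lewisKernel_le (hN.trans_le hyu) (hdec _ hyu).le x).trans ?_)
    calc B * Real.exp (-b * (y + l * h + h / 2) ^ w) / (y + l * h + h / 2)
        ≤ B * Real.exp (-b * (y + l * h + h / 2) ^ w) / y :=
          div_le_div_of_nonneg_left (by positivity) hN hyu
      _ = B / (y * h) * e l := by
          simp only [e]
          field_simp
  have hle := tsum_of_norm_bounded (hes.hasSum.mul_left (B / (y * h))) hbound
  rw [Real.norm_eq_abs] at hle
  calc Real.exp (-a * x) * (h / Real.pi *
        |∑' l : ℕ, lewisIntegrand φ a x ((((l + N : ℕ) : ℝ) + 1 / 2) * h)|)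
      ≤ Real.exp (-a * x) * (h / Real.pi * (B / (y * h) *
          ((w * b ^ (1 / w))⁻¹ * upperGamma (1 / w) (b * y ^ w)))) := by
        gcongr
        exact hle.trans (mul_le_mul_of_nonneg_left het (by positivity))
    _ = rangeError a B b w y x := by
        rw [rangeError]
        field_simp

/-! ### Asymptotics of the incomplete gamma function. -/

lemma upperGamma_nonneg (z : ℝ) {v : ℝ} (hv : 0 ≤ v) : 0 ≤ upperGamma z v :=
  setIntegral_nonneg measurableSet_Ioi fun _ hr =>
    mul_nonneg (Real.rpow_nonneg (hv.trans (le_of_lt hr)) _) (Real.exp_pos _).le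

/-- Explicit form of `Γ(z, v) = O(v ^ (z - 1) exp (-v))`. -/
lemma upperGamma_le {z v : ℝ} (hv : 0 < v) (hz : 2 * |z - 1| ≤ v) :
    upperGamma z v ≤ 2 * (v ^ (z - 1) * Real.exp (-v)) := by
  have hdom : ∀ r : ℝ, v < r → r ^ (z - 1) * Real.exp (-r) ≤
      v ^ (z - 1) * Real.exp (-v / 2) * Real.exp (-(1 / 2) * r) := fun r hr' => by
    have hr0 : 0 < r := hv.trans hr'
    -- The polynomial growth is absorbed by half of the exponential decay, using `log t ≤ t - 1` and
    -- `|z - 1| ≤ v / 2`; integrating the remaining half gives the constant `2`.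
    have h1 : (r / v) ^ (z - 1) ≤ Real.exp ((r - v) / 2) := by
      rw [Real.rpow_def_of_pos (by positivity), Real.exp_le_exp]
      have hlog0 : 0 ≤ Real.log (r / v) := Real.log_nonneg (by rw [le_div_iff₀ hv]; linarith)
      have hlog : Real.log (r / v) ≤ (r - v) / v := by
        refine (Real.log_le_sub_one_of_pos (by positivity)).trans (le_of_eq ?_)
        field_simp
      calc Real.log (r / v) * (z - 1) ≤ Real.log (r / v) * |z - 1| :=
            mul_le_mul_of_nonneg_left (le_abs_self _) hlog0
        _ ≤ (r - v) / v * (v / 2) :=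
            mul_le_mul hlog (by linarith) (abs_nonneg _)
              (div_nonneg (by linarith) hv.le)
        _ = (r - v) / 2 := by field_simp
    have h2 : r ^ (z - 1) = v ^ (z - 1) * (r / v) ^ (z - 1) := by
      rw [← Real.mul_rpow hv.le (by positivity), mul_div_cancel₀ _ hv.ne']
    rw [h2, mul_assoc, mul_assoc, ← Real.exp_add]
    refine mul_le_mul_of_nonneg_left ?_ (by positivity)
    calc (r / v) ^ (z - 1) * Real.exp (-r) ≤ Real.exp ((r - v) / 2) * Real.exp (-r) :=
          mul_le_mul_of_nonneg_right h1 (Real.exp_pos _).le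
      _ = Real.exp (-v / 2 + -(1 / 2) * r) := by rw [← Real.exp_add]; ring_nf
  have hint : IntegrableOn (fun r => v ^ (z - 1) * Real.exp (-v / 2) * Real.exp (-(1 / 2) * r))
      (Ioi v) := (integrableOn_exp_mul_Ioi (by norm_num) v).const_mul _
  calc upperGamma z v
      ≤ ∫ r in Ioi v, v ^ (z - 1) * Real.exp (-v / 2) * Real.exp (-(1 / 2) * r) := by
        refine integral_mono_of_nonneg ?_ hint ?_
        · filter_upwards [ae_restrict_mem measurableSet_Ioi] with r hr
          exact mul_nonneg (Real.rpow_nonneg (hv.trans hr).le _) (Real.exp_pos _).le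
        · filter_upwards [ae_restrict_mem measurableSet_Ioi] with r hr using hdom r hr
    _ = 2 * (v ^ (z - 1) * Real.exp (-v)) := by
        rw [integral_const_mul, integral_exp_mul_Ioi (by norm_num)]
        have : Real.exp (-v) = Real.exp (-v / 2) * Real.exp (-(1 / 2) * v) := by
          rw [← Real.exp_add]; ring_nf
        rw [this]
        ring

/-- The order of the range term. -/
lemma isBigO_upperGamma {b w : ℝ} (hb : 0 < b) (hw : 0 < w) :
    (fun y : ℝ => 1 / y * upperGamma (1 / w) (b * y ^ w)) =O[atTop]
      fun y : ℝ => y ^ (-w) * Real.exp (-b * y ^ w) := by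
  refine .of_bound (2 * b ^ (1 / w - 1)) ?_
  have ht : Tendsto (fun y : ℝ => b * y ^ w) atTop atTop :=
    (tendsto_rpow_atTop hw).const_mul_atTop hb
  filter_upwards [ht.eventually_ge_atTop (2 * |1 / w - 1|), eventually_gt_atTop 0] with y hy hy0
  have hv : 0 < b * y ^ w := by positivity
  rw [Real.norm_of_nonneg (mul_nonneg (by positivity) (upperGamma_nonneg _ hv.le)),
    Real.norm_of_nonneg (by positivity)]
  refine (mul_le_mul_of_nonneg_left (upperGamma_le hv hy) (by positivity)).trans (le_of_eq ?_)
  rw [Real.mul_rpow hb.le (by positivity), ← Real.rpow_mul hy0.le, ← neg_mul]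
  have : y ^ (w * (1 / w - 1)) = y * y ^ (-w) := by
    rw [show w * (1 / w - 1) = 1 + -w by field_simp; ring, Real.rpow_add hy0, Real.rpow_one]
  rw [this]
  field_simp

/-! ### Decay rates of the discretization error. -/

lemma tendsto_neg_div_nhdsGT_zero {k : ℝ} (hk : 0 < k) :
    Tendsto (fun h : ℝ => -k / h) (𝓝[>] 0) atBot := by
  simpa only [div_eq_mul_inv] using
    tendsto_inv_nhdsGT_zero.const_mul_atTop_of_neg (neg_lt_zero.2 hk)

lemma isBigO_inv_one_sub_exp {k : ℝ} (hk : 0 < k) :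
    (fun h : ℝ => (1 - Real.exp (-k / h))⁻¹) =O[𝓝[>] 0] fun _ => (1 : ℝ) := by
  have h1 : Tendsto (fun h : ℝ => 1 - Real.exp (-k / h)) (𝓝[>] 0) (𝓝 (1 - 0)) :=
    tendsto_const_nhds.sub (Real.tendsto_exp_atBot.comp (tendsto_neg_div_nhdsGT_zero hk))
  exact (h1.inv₀ (by norm_num)).isBigO_one ℝ

lemma isLittleO_exp_div {m n : ℝ} (h : n < m) :
    (fun h : ℝ => Real.exp (-2 * Real.pi * m / h)) =o[𝓝[>] 0]
      fun h : ℝ => Real.exp (-2 * Real.pi * n / h) := by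
  rw [Real.isLittleO_exp_comp_exp_comp]
  have hk : 0 < 2 * Real.pi * (m - n) := mul_pos Real.two_pi_pos (sub_pos.2 h)
  refine (tendsto_inv_nhdsGT_zero.const_mul_atTop hk).congr fun h => ?_
  ring

/-- A discretization error with both decay rates at least `m` is `O(exp (-2πm/h))`. -/
lemma isBigO_discError (φ : ℂ → ℂ) {a p m : ℝ} (ha : 0 < a) (hp : a < p) (hma : m ≤ a)
    (hmp : m ≤ p - a) (x : ℝ) :
    (fun h : ℝ => discError φ a p h x) =O[𝓝[>] 0] fun h : ℝ => Real.exp (-2 * Real.pi * m / h) := by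
  have key : ∀ k, 0 < k → m ≤ k → (fun h : ℝ => Real.exp (-2 * Real.pi * k / h) *
      (1 - Real.exp (-4 * Real.pi * k / h))⁻¹) =O[𝓝[>] 0]
      fun h : ℝ => Real.exp (-2 * Real.pi * m / h) := fun k hk hmk => by
    have h1 : (fun h : ℝ => Real.exp (-2 * Real.pi * k / h)) =O[𝓝[>] 0]
        fun h : ℝ => Real.exp (-2 * Real.pi * m / h) := by
      rcases hmk.lt_or_eq with h | rfl
      · exact (isLittleO_exp_div h).isBigO
      · exact isBigO_refl _ _
    have h2 := isBigO_inv_one_sub_exp (k := 4 * Real.pi * k) (by positivity)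
    simpa [neg_mul] using h1.mul h2
  refine ((key a ha hma).add ((key (p - a) (sub_pos.2 hp) hmp).const_mul_left
    (Real.exp (-p * x) * (φ (-Complex.I * (p : ℂ))).re))).congr_left fun h => ?_
  have : Real.exp (-2 * Real.pi * (p - a) / h - p * x) =
      Real.exp (-p * x) * Real.exp (-2 * Real.pi * (p - a) / h) := by
    rw [← Real.exp_add]; ring_nf
  rw [discError, this]
  ring

lemma le_div_one_sub_exp {k c h : ℝ} (hk : 0 < k) (hc : 0 ≤ c) (hh : 0 < h) :
    c ≤ c / (1 - Real.exp (-4 * Real.pi * k / h)) := by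
  have h1 : Real.exp (-4 * Real.pi * k / h) < 1 := by
    rw [Real.exp_lt_one_iff]
    exact div_neg_of_neg_of_pos (by nlinarith [mul_pos Real.pi_pos hk]) hh
  exact le_div_self hc (by linarith) (by linarith [Real.exp_pos (-4 * Real.pi * k / h)])

/-- A discretization error decays no faster than `exp (-2πm/h)`, for the smaller `m` of its two
rates. -/
lemma isBigO_exp_discError {φ : ℂ → ℂ} {a p : ℝ} (ha : 0 < a) (hp : a < p)
    (hM : 0 < (φ (-Complex.I * (p : ℂ))).re) (x : ℝ) :
    (fun h : ℝ => Real.exp (-2 * Real.pi * min a (p - a) / h)) =O[𝓝[>] 0]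
      fun h : ℝ => discError φ a p h x := by
  set M := (φ (-Complex.I * (p : ℂ))).re with hMdef
  have hlow : ∀ h : ℝ, 0 < h → Real.exp (-2 * Real.pi * a / h) +
      Real.exp (-2 * Real.pi * (p - a) / h - p * x) * M ≤ discError φ a p h x := fun h hh => by
    rw [discError]
    exact add_le_add (le_div_one_sub_exp ha (Real.exp_pos _).le hh)
      (mul_le_mul_of_nonneg_right
        (le_div_one_sub_exp (sub_pos.2 hp) (Real.exp_pos _).le hh) hM.le)
  rcases min_choice a (p - a) with hmin | hmin <;> rw [hmin]
  · refine .of_bound 1 ?_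
    filter_upwards [self_mem_nhdsWithin] with h hh
    rw [Real.norm_of_nonneg (Real.exp_pos _).le, one_mul]
    refine le_trans ?_ (Real.le_norm_self _)
    have : 0 ≤ Real.exp (-2 * Real.pi * (p - a) / h - p * x) * M := by positivity
    linarith [hlow h hh]
  -- The constant undoes the coefficient `exp (-p x) M` of the second term, so positivity of the
  -- moment `M` is essential here.
  · refine .of_bound (Real.exp (p * x) / M) ?_
    filter_upwards [self_mem_nhdsWithin] with h hh
    rw [Real.norm_of_nonneg (Real.exp_pos _).le]
    have h1 : Real.exp (-2 * Real.pi * (p - a) / h) = Real.exp (p * x) / M *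
        (Real.exp (-2 * Real.pi * (p - a) / h - p * x) * M) := by
      rw [Real.exp_sub]
      field_simp
    rw [h1]
    refine mul_le_mul_of_nonneg_left (le_trans ?_ (Real.le_norm_self _)) (by positivity)
    linarith [hlow h hh, Real.exp_pos (-2 * Real.pi * a / h)]

/-- The smaller of the two rates decides which discretization error decays faster. -/
lemma isLittleO_discError {φ : ℂ → ℂ} {a p a' p' : ℝ} (ha : 0 < a) (hp : a < p) (ha' : 0 < a')
    (hp' : a' < p') (hM : 0 < (φ (-Complex.I * (p' : ℂ))).re)
    (hlt : min a' (p' - a') < min a (p - a)) (x : ℝ) :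
    (fun h : ℝ => discError φ a p h x) =o[𝓝[>] 0] fun h : ℝ => discError φ a' p' h x :=
  ((isBigO_discError φ ha hp (min_le_left _ _) (min_le_right _ _) x).trans_isLittleO
    (isLittleO_exp_div hlt)).trans_isBigO (isBigO_exp_discError ha' hp' hM x)

lemma discError_half (φ : ℂ → ℂ) (q h x : ℝ) :
    discError φ (q / 2) q h x = discTerm φ q h x := by
  have e1 : -2 * Real.pi * (q / 2) / h = -Real.pi * q / h := by ring
  have e2 : -4 * Real.pi * (q / 2) / h = -2 * Real.pi * q / h := by ring
  rw [discError, discTerm, sub_half, e1, e2]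
  ring

lemma errorCDF_eq (φ : ℂ → ℂ) (q B b w h : ℝ) (N : ℕ) (x : ℝ) :
    errorCDF φ q B b w h N x = rangeError (q / 2) B b w (N * h) x + discError φ (q / 2) q h x := by
  rw [errorCDF, rangeError, discError_half, show -x * q / 2 = -(q / 2) * x by ring]

/-! ### Total error. -/

section Random

variable {Ω : Type*} [MeasurableSpace Ω] {μ : Measure Ω} {X : Ω → ℝ} [IsProbabilityMeasure μ]

lemma charFn_neg_I_mul_re_pos {p : ℝ} (h : Integrable (fun ω => Real.exp (p * X ω)) μ) :
    0 < (charFn μ X (-Complex.I * (p : ℂ))).re := by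
  rw [charFn_neg_I_mul_re]
  exact mgf_pos h

/-- Total error of the truncated midpoint rule for the Lewis formula. -/
lemma abs_measureReal_le_sub_lewisSum_le (hX : Measurable X) {a p B b w h : ℝ} (ha : 0 < a)
    (hI : Integrable (fun ω => Real.exp (a * X ω)) μ) (hp : a < p)
    (hIp : Integrable (fun ω => Real.exp (p * X ω)) μ) (hb : 0 < b) (hw : 0 < w) (hh : 0 < h)
    {N : ℕ} (hN : 0 < N * h)
    (hconv : ConvexOn ℝ (Ici (N * h)) fun u : ℝ => Real.exp (-b * u ^ w))
    (hdec : ∀ u : ℝ, N * h ≤ u →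
      ‖charFn μ X ((u : ℂ) - Complex.I * (a : ℂ))‖ < B * Real.exp (-b * u ^ w)) (x : ℝ) :
    |μ.real {ω | X ω ≤ x} - lewisSum (charFn μ X) a h N x| ≤
      rangeError a B b w (N * h) x + discError (charFn μ X) a p h x := by
  have hdec' : ∀ᶠ u : ℝ in atTop,
      ‖charFn μ X ((u : ℂ) - Complex.I * (a : ℂ))‖ < B * Real.exp (-b * u ^ w) :=
    eventually_atTop.2 ⟨N * h, hdec⟩
  have hdisc := abs_tsum_lewisIntegrand_sub_le hX ha hI hp hIp hb hw hdec' hh x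
  have hrange := abs_tsum_lewisIntegrand_le hb hw hh hN hconv hdec x
  set g : ℕ → ℝ := fun l => lewisIntegrand (charFn μ X) a x (((l : ℝ) + 1 / 2) * h)
  have hs : Summable g :=
    (Complex.hasSum_re (summable_lewisKernel hb hw hdec' hh x).hasSum).summable
  have hsplit := hs.sum_add_tsum_nat_add N
  set T := ∑' l, g (l + N)
  have hP : μ.real {ω | X ω ≤ x} = 1 - μ.real {ω | x < X ω} := by
    rw [measureReal_le_eq_one_sub_expTail hX a, measureReal_gt_eq a]
  -- The error splits into that of the infinite midpoint sum and the contribution of the discarded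
  -- midpoints.
  have heq : μ.real {ω | X ω ≤ x} - lewisSum (charFn μ X) a h N x =
      (Real.exp (-a * x) * (h / Real.pi * ∑' l, g l) - μ.real {ω | x < X ω}) -
        Real.exp (-a * x) * (h / Real.pi * T) := by
    rw [hP, lewisSum, ← Finset.sum_mul, ← hsplit]
    ring
  have hT : |Real.exp (-a * x) * (h / Real.pi * T)| =
      Real.exp (-a * x) * (h / Real.pi * |T|) := by
    rw [abs_mul, abs_mul, abs_of_pos (Real.exp_pos _), abs_of_pos (div_pos hh Real.pi_pos)]
  rw [heq, add_comm]
  exact (abs_sub _ _).trans (add_le_add hdisc (hT.le.trans hrange))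

end Random

end LewisCDF

theorem proposition1 {Ω : Type*} [MeasurableSpace Ω] (μ : Measure Ω) [IsProbabilityMeasure μ]
    (f : ℝ≥0 → Ω → ℝ) (hf : IsAdditiveProcess μ f)
    (pm pp : ℝ≥0 → ℝ) (hstrip : ∀ t, 0 < t → IsAnalyticityStrip μ (f t) (pm t) (pp t))
    -- the strip bounds are non-increasing
    (hA1 : AntitoneOn pm (Ioi 0) ∧ AntitoneOn pp (Ioi 0))
    -- exponential decay of the characteristic functions of the increments
    (B b w : ℝ≥0 → ℝ≥0 → ℝ)
    (hA2 : ∀ s t, s < t → ExpDecay (incrCharFn μ f s t) (pp t) (B s t) (b s t) (w s t))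
    (s t : ℝ≥0) (hst : s < t) :
    -- the Lewis formula makes sense and gives the distribution function, for every shift
    (IsAnalyticityStrip μ (incr f s t) (pm t) (pp t) ∧
      ∀ a ∈ Ioo 0 (pp t + 1), ∀ x : ℝ,
        IntegrableOn (lewisIntegrand (incrCharFn μ f s t) a x) (Ioi 0) ∧
        incrCDF μ f s t x = lewisCDF (incrCharFn μ f s t) a x) ∧
    -- the error bound, for `N h` sufficiently large
    (∃ U : ℝ, 0 < U ∧ ∀ h : ℝ, 0 < h → ∀ N : ℕ, U ≤ (N : ℝ) * h → ∀ x : ℝ,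
      -- shift `(p⁺ + 1) / 2`, if `φ (-i (p⁺ + 1))` is finite
      (Integrable (fun ω => Real.exp ((pp t + 1) * incr f s t ω)) μ →
        |incrCDF μ f s t x - lewisSum (incrCharFn μ f s t) ((pp t + 1) / 2) h N x| ≤
          errorCDF (incrCharFn μ f s t) (pp t + 1) (B s t) (b s t) (w s t) h N x) ∧
      -- any shift `a`, any `p ≤ p⁺ + 1` with `φ (-i p)` finite
      (∀ a ∈ Ioo 0 (pp t + 1), ∀ p ∈ Ioc a (pp t + 1),
        Integrable (fun ω => Real.exp (p * incr f s t ω)) μ →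
        |incrCDF μ f s t x - lewisSum (incrCharFn μ f s t) a h N x| ≤
          rangeError a (B s t) (b s t) (w s t) ((N : ℝ) * h) x +
            discError (incrCharFn μ f s t) a p h x)) ∧
    -- order of the range term
    ((fun y : ℝ => 1 / y * upperGamma (1 / w s t) (b s t * y ^ w s t)) =O[atTop]
      fun y : ℝ => y ^ (-w s t) * Real.exp (-b s t * y ^ w s t)) ∧
    -- the shift `(p⁺ + 1) / 2` is the only one with the fastest exponential decay
    (∀ a ∈ Ioo 0 (pp t + 1), a ≠ (pp t + 1) / 2 →
      ∃ p ∈ Ioo ((pp t + 1) / 2) (pp t + 1), ∀ p' ∈ Ioc a (pp t + 1),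
        Integrable (fun ω => Real.exp (p' * incr f s t ω)) μ → ∀ x : ℝ,
        (fun h : ℝ => discError (incrCharFn μ f s t) ((pp t + 1) / 2) p h x) =o[𝓝[>] 0]
          fun h : ℝ => discError (incrCharFn μ f s t) a p' h x) ∧
    -- if `φ (-i (p⁺ + 1))` is finite, order and optimality of the discretization term itself
    (Integrable (fun ω => Real.exp ((pp t + 1) * incr f s t ω)) μ → ∀ x : ℝ,
      ((fun h : ℝ => discTerm (incrCharFn μ f s t) (pp t + 1) h x) =O[𝓝[>] 0]
        fun h : ℝ => Real.exp (-Real.pi * (pp t + 1) / h)) ∧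
      (∀ h : ℝ, discError (incrCharFn μ f s t) ((pp t + 1) / 2) (pp t + 1) h x =
        discTerm (incrCharFn μ f s t) (pp t + 1) h x) ∧
      ∀ a ∈ Ioo 0 (pp t + 1), ∀ p ∈ Ioc a (pp t + 1),
        (a, p) ≠ ((pp t + 1) / 2, pp t + 1) →
        (fun h : ℝ => discTerm (incrCharFn μ f s t) (pp t + 1) h x) =o[𝓝[>] 0]
          fun h : ℝ => discError (incrCharFn μ f s t) a p h x) := by
  set X := incr f s t with hXdef
  set φ := incrCharFn μ f s t with hφdef
  set q := pp t + 1 with hqdef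
  have hX : Measurable X := hf.measurable_incr s t
  have hS : IsAnalyticityStrip μ X (pm t) (pp t) :=
    hf.isAnalyticityStrip_incr hst.le (hstrip t (bot_le.trans_lt hst))
  have hq : 0 < q := by linarith [hS.pp_bound]
  have hI : ∀ a ∈ Ioo 0 q, Integrable (fun ω => Real.exp (a * X ω)) μ := fun a ha =>
    hS.integrable_exp ⟨by linarith [ha.1, hS.pm_pos], ha.2⟩
  obtain ⟨-, hb, hw, hdec⟩ := hA2 s t hst
  have hhalf : q / 2 ∈ Ioo 0 q := ⟨by linarith, by linarith⟩
  -- The decay threshold is uniform in the shift, so one `U₀` serves all `a`; the later maximum with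
  -- `1` ensures `N h > 0`.
  obtain ⟨U₀, hU₀⟩ := eventually_atTop.1
    (hdec.and (eventually_convexOn_exp_neg_mul_rpow hb hw))
  have hgen : ∀ h : ℝ, 0 < h → ∀ N : ℕ, max U₀ 1 ≤ (N : ℝ) * h → ∀ x : ℝ,
      ∀ a ∈ Ioo 0 q, ∀ p ∈ Ioc a q, Integrable (fun ω => Real.exp (p * X ω)) μ →
      |incrCDF μ f s t x - lewisSum φ a h N x| ≤
        rangeError a (B s t) (b s t) (w s t) (N * h) x + discError φ a p h x := by
    intro h hh N hN x a ha p hp hIp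
    have hN0 : U₀ ≤ N * h := (le_max_left _ _).trans hN
    exact abs_measureReal_le_sub_lewisSum_le hX ha.1 (hI a ha) hp.1 hIp hb hw hh
      (one_pos.trans_le ((le_max_right _ _).trans hN)) (hU₀ _ hN0).2
      (fun u hu => (hU₀ u (hN0.trans hu)).1 a ha) x
  refine ⟨⟨hS, fun a ha x => ?_⟩,
    ⟨max U₀ 1, lt_max_of_lt_right one_pos, fun h hh N hN x =>
      ⟨fun hIq => ?_, hgen h hh N hN x⟩⟩,
    isBigO_upperGamma hb hw, fun a ha hne => ?_, fun hIq x => ⟨?_, fun h => ?_, ?_⟩⟩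
  · have hdeca := hdec.mono fun u hu => hu a ha
    exact ⟨integrableOn_lewisIntegrand hX ha.1 (hI a ha) hb hw hdeca x,
      measureReal_le_eq_lewisCDF hX ha.1 (hI a ha) hb hw hdeca x⟩
  · rw [errorCDF_eq]
    exact hgen h hh N hN x _ hhalf q ⟨hhalf.2, le_rfl⟩ hIq
  · have hm : min a (q - a) < q / 2 := by
      rcases hne.lt_or_gt with h | h
      · exact min_lt_of_left_lt h
      · exact min_lt_of_right_lt (by linarith)
    have hm0 : 0 < min a (q - a) := lt_min ha.1 (by linarith [ha.2])
    -- With `m = min a (q - a) < q/2`, the witness `p` is the midpoint of `q/2 + m` and `q`. Then `p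
    -- < q` and the rate `p - q/2` still exceeds `m`, which bounds the rate of every competitor.
    refine ⟨(q + (q / 2 + min a (q - a))) / 2, ⟨by linarith, by linarith⟩,
      fun p' hp' hIp' x => ?_⟩
    refine isLittleO_discError hhalf.1 (by linarith) ha.1 hp'.1 (charFn_neg_I_mul_re_pos hIp')
      ((min_le_min_left a (sub_le_sub_right hp'.2 a)).trans_lt (lt_min hm ?_)) x
    linarith
  · simp_rw [← discError_half]
    refine (isBigO_discError φ hhalf.1 hhalf.2 le_rfl (by linarith) x).congr_right fun h => ?_
    ring_nf
  · exact discError_half φ q h x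
  · intro a ha p hp hne
    have hIp : Integrable (fun ω => Real.exp (p * X ω)) μ := by
      rcases hp.2.lt_or_eq with h | rfl
      · exact hI p ⟨ha.1.trans hp.1, h⟩
      · exact hIq
    simp_rw [← discError_half]
    refine isLittleO_discError hhalf.1 hhalf.2 ha.1 hp.1 (charFn_neg_I_mul_re_pos hIp) ?_ x
    rw [sub_half, min_self]
    -- A competing rate of at least `q/2` means `a ≥ q/2` and `p - a ≥ q/2`, which under `p ≤ q`
    -- forces `a = q/2` and `p = q`.
    by_contra! hle
    have h1 := hle.trans (min_le_left _ _)
    have h2 := hle.trans (min_le_right _ _)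
    exact hne (Prod.ext (by linarith [hp.2]) (by linarith [hp.2]))
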